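/- Let $p,k\ge 1$ be integers and let $\lambda=(\lambda_1\ge\lambda_2\ge\dots)$ be a partition of $pk$ with at most $p$ (non-zero) parts. For an integer $d\ge 0$ write $d\lambda=(d\lambda_1,d\lambda_2,\dots)$, and let $c^{d\lambda}_{p,dk}$ be the number of semistandard Young tableaux of shape $d\lambda$ filled with exactly $dk$ copies of each of $1,\dots,p$. Call $\lambda$ exceptional if it is of one of the forms $$(pk),\quad (k^{p}),\quad (a^{p-1}),\quad (b,c^{p-1}),\quad (b^{p-1},c)$$ with integers $a\ge 0$ and $b>c\ge 0$ (exponents denote repetition, trailing zeros are ignored). A function $q:\{0,1,2,\dots\}\to\{0,1,2,\dots\}$ is a quasi-polynomial of degree $n$ if $q(d)=\gamma_n(d)d^n+\dots+\gamma_1(d)d+\gamma_0(d)$ for all $d\ge 0$, where $\gamma_0,\dots,\gamma_n:\{0,1,2,\dots\}\to\mathbb{Q}$ are periodic and the leading term $\gamma_n$ is not identically $0$. 1. If $\lambda$ is not exceptional, then $d\mapsto c^{d\lambda}_{p,dk}$ ($d\ge 0$) is a non-negative, non-decreasing quasi-polynomial of positive degree whose leading term $\gamma_n$ is a constant function. 2.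 If $\lambda$ is exceptional, then $c^{d\lambda}_{p,dk}=1$ for all $d\ge 0$. -/

import Mathlib

/-- The dilation `dλ = (dλ₁, dλ₂, …)` of a partition `λ = (λ₁, λ₂, …)`. -/
def YoungDiagram.dilate (d : ℕ) (μ : YoungDiagram) : YoungDiagram :=
  YoungDiagram.ofRowLens (μ.rowLens.map (fun r => d * r)) (by
    have h := μ.rowLens_sorted
    rw [List.sortedGE_iff_pairwise] at h ⊢
    exact h.map _ (fun a b hab => Nat.mul_le_mul_left d hab))

theorem YoungDiagram.mem_dilate {d : ℕ} {μ : YoungDiagram} {i j : ℕ} :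
    (i, j) ∈ μ.dilate d ↔ j < d * μ.rowLen i := by
  unfold YoungDiagram.dilate
  rw [YoungDiagram.mem_ofRowLens]
  constructor
  · rintro ⟨h, hj⟩
    simpa using hj
  · intro hj
    have hi : i < μ.colLen 0 := by
      rw [← YoungDiagram.mem_iff_lt_colLen, YoungDiagram.mem_iff_lt_rowLen]
      exact Nat.pos_of_ne_zero (fun h => by simp [h] at hj)
    exact ⟨by simpa using hi, by simpa using hj⟩

theorem YoungDiagram.rowLen_dilate (d : ℕ) (μ : YoungDiagram) (i : ℕ) :
    (μ.dilate d).rowLen i = d * μ.rowLen i := by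
  have h (j : ℕ) : j < (μ.dilate d).rowLen i ↔ j < d * μ.rowLen i := by
    rw [← YoungDiagram.mem_iff_lt_rowLen, YoungDiagram.mem_dilate]
  have h1 := h ((μ.dilate d).rowLen i)
  have h2 := h (d * μ.rowLen i)
  omega

/-- The row lengths of `μ` are the entries of the list `w`, followed by zeros; that is, `μ` is the
partition written `(w₁, w₂, …)`, where trailing zeros are permitted. -/
def YoungDiagram.HasParts (μ : YoungDiagram) (w : List ℕ) : Prop :=
  ∀ i : ℕ, μ.rowLen i = w.getD i 0

/-- Partitions of the form `(pk)`, `(k^p)`, `(a^{p-1})`, `(b, c^{p-1})` or `(b^{p-1}, c)`,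
where `b > c`. -/
def YoungDiagram.IsExceptional (p k : ℕ) (μ : YoungDiagram) : Prop :=
  μ.HasParts [p * k] ∨
  μ.HasParts (List.replicate p k) ∨
  (∃ a : ℕ, μ.HasParts (List.replicate (p - 1) a)) ∨
  (∃ b c : ℕ, c < b ∧ μ.HasParts (b :: List.replicate (p - 1) c)) ∨
  (∃ b c : ℕ, c < b ∧ μ.HasParts (List.replicate (p - 1) b ++ [c]))

/-- The tableau `T` is filled with `k` copies each of `1, …, p` (and with nothing else). -/
def SemistandardYoungTableau.HasContent {μ : YoungDiagram} (T : SemistandardYoungTableau μ)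
    (p k : ℕ) : Prop :=
  ∀ m : ℕ, (μ.cells.filter (fun x => T x.1 x.2 = m)).card = if m ∈ Finset.Icc 1 p then k else 0

/-- `c_{p,k}^μ`: the number of semistandard Young tableaux of shape `μ` filled with `k` copies each
of `1, …, p`. -/
noncomputable def tableauCount (p k : ℕ) (μ : YoungDiagram) : ℕ :=
  Nat.card {T : SemistandardYoungTableau μ // T.HasContent p k}

/-- There are only finitely many such tableaux, so that `tableauCount` is a genuine count. -/
theorem finite_hasContent (p k : ℕ) (μ : YoungDiagram) :
    Finite {T : SemistandardYoungTableau μ // T.HasContent p k} := by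
  have hle (T : {T : SemistandardYoungTableau μ // T.HasContent p k}) (x : μ.cells) :
      T.1 x.1.1 x.1.2 < p + 1 := by
    by_contra hlt
    have h := T.2 (T.1 x.1.1 x.1.2)
    rw [if_neg (by rw [Finset.mem_Icc]; omega), Finset.card_eq_zero] at h
    have hx : x.1 ∈ μ.cells.filter (fun y => T.1 y.1 y.2 = T.1 x.1.1 x.1.2) :=
      Finset.mem_filter.2 ⟨x.2, rfl⟩
    rw [h] at hx
    exact Finset.notMem_empty _ hx
  refine Finite.of_injective
    (fun T => (fun x => ⟨T.1 x.1.1 x.1.2, hle T x⟩ : μ.cells → Fin (p + 1))) ?_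
  intro S T h
  apply Subtype.ext
  apply SemistandardYoungTableau.ext
  intro i j
  by_cases hc : (i, j) ∈ μ
  · have := congrFun h ⟨(i, j), hc⟩
    simpa using this
  · rw [S.1.zeros hc, T.1.zeros hc]

/-- `f` is a quasi-polynomial of degree `n` with coefficient functions `coef 0, …, coef n`:
`f d = coef n d * d ^ n + … + coef 0 d` for all `d`, the coefficient functions are periodic with a
common positive period, and `coef n` (the leading term) is not identically zero. -/
def IsQuasiPolynomial (f : ℕ → ℕ) (n : ℕ) (coef : ℕ → ℕ → ℚ) : Prop :=
  (∀ d : ℕ, (f d : ℚ) = ∑ i ∈ Finset.range (n + 1), coef i d * (d : ℚ) ^ i) ∧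
  (∃ m : ℕ, 0 < m ∧ ∀ i ≤ n, Function.Periodic (coef i) m) ∧
  (∃ d : ℕ, coef n d ≠ 0)

/-! Counting, in each row of a tableau, the entries at most `j` turns the tableaux with `k` copies
of each of `1, …, p` into Gelfand–Tsetlin patterns whose `j`-th row has sum `j * k`
(`tableauCount_eq_ncard`). These are the lattice points of a rational polytope, and passing to `dλ`,
`dk` dilates it by `d`.

Ehrhart's theorem (`isQuasiPoly_inequalities`) then makes the count a quasi-polynomial. It rests on
Elliott's reduction: the solutions of a linear equation are cut along `c a = c b`, and each half is
reparametrised by solutions of an equation with smaller coefficients, until all coefficients have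
one sign and the equation merely kills variables. The resulting formula may fail at `d = 0`; the
correction needed there obeys the same recursion and vanishes once a solution of positive degree
exists (`isQuasiPoly_coneSols_of_exists`).

Patterns can be added. Adding a fixed one is an injection, so the count is non-decreasing. Two
distinct patterns `x`, `y` give the `d + 1` patterns `n • x + (d - n) • y`, so the count is
unbounded. A monotone quasi-polynomial is squeezed between its values at consecutive multiples of
the period, so all residue classes share one leading term (`IsQuasiPoly.exists_isQuasiPolynomial`).

Interlacing decides which case occurs. If `λ` is constant apart from its first or its last part,
every lower row is forced (`unique_of_tail`, `unique_of_init`). Otherwise `λ` has two drops, which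
leaves two choices for the next row, or a single interior drop, and then the next row has two drops
(`YoungDiagram.exists_ne_isGTPattern`). -/

/-! ### Quasi-polynomials and their differences. -/

open Polynomial in
/-- `f` agrees with a polynomial on every arithmetic progression of some fixed positive step. -/
def IsQuasiPoly (f : ℕ → ℚ) : Prop :=
  ∃ m : ℕ, 0 < m ∧ ∀ r : ℕ, ∃ P : ℚ[X], ∀ s : ℕ, f (m * s + r) = P.eval (s : ℚ)

namespace IsQuasiPoly

open Polynomial

theorem refine_step {f : ℕ → ℚ} {m : ℕ}
    (h : ∀ r : ℕ, ∃ P : ℚ[X], ∀ s : ℕ, f (m * s + r) = P.eval (s : ℚ)) (l r : ℕ) :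
    ∃ P : ℚ[X], ∀ s : ℕ, f (m * l * s + r) = P.eval (s : ℚ) := by
  obtain ⟨P, hP⟩ := h r
  refine ⟨P.comp (C (l : ℚ) * X), fun s => ?_⟩
  rw [mul_assoc, hP]
  simp

theorem const (c : ℚ) : IsQuasiPoly fun _ => c :=
  ⟨1, one_pos, fun _ => ⟨C c, fun _ => by simp⟩⟩

theorem add {f g : ℕ → ℚ} (hf : IsQuasiPoly f) (hg : IsQuasiPoly g) :
    IsQuasiPoly fun d => f d + g d := by
  obtain ⟨m, hm, h⟩ := hf
  obtain ⟨l, hl, h'⟩ := hg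
  refine ⟨m * l, Nat.mul_pos hm hl, fun r => ?_⟩
  obtain ⟨P, hP⟩ := refine_step h l r
  obtain ⟨Q, hQ⟩ := refine_step h' m r
  refine ⟨P + Q, fun s => ?_⟩
  have := hQ s
  rw [mul_comm l m] at this
  rw [eval_add, ← hP, ← this]

theorem neg {f : ℕ → ℚ} (hf : IsQuasiPoly f) : IsQuasiPoly fun d => - f d := by
  obtain ⟨m, hm, h⟩ := hf
  refine ⟨m, hm, fun r => ?_⟩
  obtain ⟨P, hP⟩ := h r
  exact ⟨-P, fun s => by rw [eval_neg, ← hP]⟩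

theorem sub {f g : ℕ → ℚ} (hf : IsQuasiPoly f) (hg : IsQuasiPoly g) :
    IsQuasiPoly fun d => f d - g d := by
  simpa only [sub_eq_add_neg] using hf.add hg.neg

theorem shift {f : ℕ → ℚ} (hf : IsQuasiPoly f) (e : ℕ) : IsQuasiPoly fun d => f (d + e) := by
  obtain ⟨m, hm, h⟩ := hf
  refine ⟨m, hm, fun r => ?_⟩
  obtain ⟨P, hP⟩ := h (r + e)
  exact ⟨P, fun s => by rw [← hP, ← add_assoc]⟩

end IsQuasiPoly

-- Discrete integration: by Faulhaber's formula the partial sums of a monomial are a difference of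
-- Bernoulli polynomial values.
open Polynomial in
theorem Polynomial.exists_eval_eq_of_forall_sub {g : ℕ → ℚ} {P : ℚ[X]}
    (h : ∀ s : ℕ, g (s + 1) - g s = P.eval (s : ℚ)) : ∃ Q : ℚ[X], ∀ s : ℕ, g s = Q.eval (s : ℚ) := by
  have key : ∃ Q : ℚ[X], ∀ s : ℕ, ∑ i ∈ Finset.range s, P.eval (i : ℚ) = Q.eval (s : ℚ) := by
    clear h
    induction P using Polynomial.induction_on' with
    | add p q hp hq =>
      obtain ⟨P, hP⟩ := hp
      obtain ⟨Q, hQ⟩ := hq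
      exact ⟨P + Q, fun s => by simp only [eval_add, Finset.sum_add_distrib, hP, hQ]⟩
    | monomial n a =>
      refine ⟨C (a / (n + 1)) * (Polynomial.bernoulli (n + 1) - C (_root_.bernoulli (n + 1))),
        fun s => ?_⟩
      have := Polynomial.sum_range_pow_eq_bernoulli_sub s n
      simp only [eval_monomial, ← Finset.mul_sum, eval_mul, eval_C, eval_sub]
      rw [← this]
      have : (n : ℚ) + 1 ≠ 0 := by positivity
      field_simp
  obtain ⟨Q, hQ⟩ := key
  refine ⟨Q + C (g 0), fun s => ?_⟩
  rw [eval_add, ← hQ, eval_C]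
  simp only [← h]
  rw [Finset.sum_range_sub]
  ring

/-- Telescoping `m` steps of length `e` gives a step of length `m * e`. This is a multiple of the
period `m`, so along a class modulo `m * e` the first difference is a polynomial and can be summed.
-/
theorem IsQuasiPoly.of_sub {f : ℕ → ℚ} {e : ℕ} (he : 0 < e)
    (h : IsQuasiPoly fun d => f (d + e) - f d) : IsQuasiPoly f := by
  obtain ⟨m, hm, h⟩ := h
  refine ⟨m * e, Nat.mul_pos hm he, fun r => ?_⟩
  have key : ∀ j : ℕ, ∃ P : Polynomial ℚ, ∀ s : ℕ,
      f (m * e * s + r + j * e) - f (m * e * s + r) = P.eval (s : ℚ) := by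
    intro j
    induction j with
    | zero => exact ⟨0, fun s => by simp⟩
    | succ j ih =>
      obtain ⟨P, hP⟩ := ih
      obtain ⟨Q, hQ⟩ := refine_step (f := fun d => f (d + e) - f d) h e (r + j * e)
      refine ⟨P + Q, fun s => ?_⟩
      rw [Polynomial.eval_add, ← hP, ← hQ]
      rw [show m * e * s + r + (j + 1) * e = m * e * s + (r + j * e) + e by ring]
      rw [show m * e * s + (r + j * e) = m * e * s + r + j * e by ring]
      ring
  obtain ⟨P, hP⟩ := key m
  refine Polynomial.exists_eval_eq_of_forall_sub (P := P) fun s => ?_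
  rw [← hP]
  ring_nf

/-! ### Elliott's reduction. -/

/-- Coefficient vectors supported on `s` whose combination of the vectors `A i` lies in `P`. -/
def coneSols {ι G : Type*} [Fintype ι] [AddCommMonoid G] (P : Set G) (A : ι → G) (s : Finset ι) :
    Set (ι → ℕ) :=
  {c | (∀ i, i ∉ s → c i = 0) ∧ ∑ i, c i • A i ∈ P}

theorem add_single_injective {ι : Type*} [DecidableEq ι] {a b : ι} (hab : a ≠ b) :
    Function.Injective fun c : ι → ℕ => c + Pi.single a (c b) := by
  intro c c' h
  have hb : c b = c' b := by simpa [hab.symm] using congrFun h b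
  funext i
  have := congrFun h i
  simp only [Pi.add_apply, hb] at this
  omega

section Elliott

variable {ι G : Type*} [Fintype ι] [DecidableEq ι] [AddCommMonoid G]

theorem sum_add_single_smul (c : ι → ℕ) (A : ι → G) (a b : ι) :
    ∑ i, (c + Pi.single a (c b) : ι → ℕ) i • A i =
      ∑ i, c i • (A + Pi.single b (A a) : ι → G) i := by
  simp only [Pi.add_apply, add_smul, smul_add, Finset.sum_add_distrib]
  congr 1
  rw [Finset.sum_eq_single a, Finset.sum_eq_single b] <;>
    simp +contextual

/-- When `c b ≤ c a`, one has `c a • A a + c b • A b = (c a - c b) • A a + c b • (A a + A b)`, so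
these solutions are parametrised by the family with `A a + A b` in place of `A b`. -/
theorem image_coneSols {P : Set G} {A : ι → G} {s : Finset ι} {a b : ι} (hab : a ≠ b)
    (ha : a ∈ s) :
    (fun c : ι → ℕ => c + Pi.single a (c b)) '' coneSols P (A + Pi.single b (A a)) s =
      {c ∈ coneSols P A s | c b ≤ c a} := by
  ext c
  constructor
  · rintro ⟨c, ⟨h1, h2⟩, rfl⟩
    refine ⟨⟨fun i hi => ?_, ?_⟩, ?_⟩
    · have : i ≠ a := fun h => hi (h ▸ ha)
      simp [this, h1 i hi]
    · rwa [sum_add_single_smul]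
    · simp [hab.symm]
  · rintro ⟨⟨h1, h2⟩, h3⟩
    have key : (fun c : ι → ℕ => c + Pi.single a (c b)) (c - Pi.single a (c b)) = c := by
      funext i
      by_cases hi : i = a
      · subst hi; simp [hab.symm, h3]
      · simp [hi, hab.symm]
    refine ⟨c - Pi.single a (c b), ⟨fun i hi => by simp [h1 i hi], ?_⟩, key⟩
    rw [← sum_add_single_smul]
    simp only at key
    rwa [key]

/-- On the wall `c b = c a` the new coefficient of `A a` is zero, so `a` drops out of the support.
-/
theorem image_coneSols_erase {P : Set G} {A : ι → G} {s : Finset ι} {a b : ι} (hab : a ≠ b)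
    (ha : a ∈ s) :
    (fun c : ι → ℕ => c + Pi.single a (c b)) '' coneSols P (A + Pi.single b (A a)) (s.erase a) =
      {c ∈ coneSols P A s | c b = c a} := by
  have h : coneSols P (A + Pi.single b (A a)) (s.erase a) =
      {c ∈ coneSols P (A + Pi.single b (A a)) s | c a = 0} := by
    ext c
    constructor
    · rintro ⟨h1, h2⟩
      exact ⟨⟨fun i hi => h1 i (by simp [hi]), h2⟩, h1 a (by simp)⟩
    · rintro ⟨⟨h1, h2⟩, h3⟩
      refine ⟨fun i hi => ?_, h2⟩
      by_cases hia : i = a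
      · rw [hia, h3]
      · exact h1 i (by simpa [hia] using hi)
  rw [h]
  ext c
  constructor
  · rintro ⟨c, ⟨h1, h2⟩, rfl⟩
    have := (image_coneSols (P := P) (A := A) hab ha).subset ⟨c, h1, rfl⟩
    exact ⟨this.1, by simp [hab.symm, h2]⟩
  · rintro ⟨h1, h2⟩
    obtain ⟨c', hc', rfl⟩ := (image_coneSols (P := P) (A := A) hab ha).superset ⟨h1, h2.le⟩
    exact ⟨c', ⟨hc', by simpa [hab.symm] using h2⟩, rfl⟩

theorem finite_coneSols_add_single {P : Set G} {A : ι → G} {s : Finset ι} {a b : ι} (hab : a ≠ b)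
    (ha : a ∈ s) (h : (coneSols P A s).Finite) :
    (coneSols P (A + Pi.single b (A a)) s).Finite := by
  refine Set.Finite.of_finite_image ?_ (add_single_injective hab).injOn
  rw [image_coneSols hab ha]
  exact h.subset fun c hc => hc.1

theorem finite_coneSols_erase {P : Set G} {A : ι → G} {s : Finset ι} {a : ι}
    (h : (coneSols P A s).Finite) : (coneSols P A (s.erase a)).Finite :=
  h.subset fun _ hc => ⟨fun i hi => hc.1 i fun h => hi (Finset.mem_of_mem_erase h), hc.2⟩

/-- Inclusion–exclusion for the halves `c b ≤ c a` and `c a ≤ c b`, which meet in the wall `c b = c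
a`. -/
theorem ncard_coneSols_split {P : Set G} {A : ι → G} {s : Finset ι} {a b : ι} (hab : a ≠ b)
    (ha : a ∈ s) (hb : b ∈ s) (h : (coneSols P A s).Finite) :
    (coneSols P A s).ncard + (coneSols P (A + Pi.single b (A a)) (s.erase a)).ncard =
      (coneSols P (A + Pi.single b (A a)) s).ncard +
      (coneSols P (A + Pi.single a (A b)) s).ncard := by
  have e1 := Set.ncard_image_of_injective (coneSols P (A + Pi.single b (A a)) (s.erase a))
    (add_single_injective hab)
  have e2 := Set.ncard_image_of_injective (coneSols P (A + Pi.single b (A a)) s)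
    (add_single_injective hab)
  have e3 := Set.ncard_image_of_injective (coneSols P (A + Pi.single a (A b)) s)
    (add_single_injective hab.symm)
  rw [image_coneSols_erase hab ha] at e1
  rw [image_coneSols hab ha] at e2
  rw [image_coneSols hab.symm hb] at e3
  rw [← e1, ← e2, ← e3]
  rw [← Set.ncard_union_add_ncard_inter {c | c ∈ coneSols P A s ∧ c b ≤ c a}
    {c | c ∈ coneSols P A s ∧ c a ≤ c b} (h.subset fun c hc => hc.1) (h.subset fun c hc => hc.1)]
  congr 2
  · ext c
    exact ⟨fun hc => (le_total (c b) (c a)).imp (fun h => ⟨hc, h⟩) fun h => ⟨hc, h⟩,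
      fun hc => hc.elim (fun h => h.1) fun h => h.1⟩
  · ext c
    exact ⟨fun hc => ⟨⟨hc.1, hc.2.le⟩, ⟨hc.1, hc.2.ge⟩⟩,
      fun hc => ⟨hc.1.1, le_antisymm hc.1.2 hc.2.2⟩⟩

/-- One step of Elliott's reduction, in which a coefficient of maximal absolute value is used to
remove the coefficients of the opposite sign. -/
theorem elliott_aux {φ : G →+ ℤ} {Good : (ι → G) → Finset ι → Prop}
    (hsplit : ∀ A s a b, a ≠ b → a ∈ s → b ∈ s → Good (A + Pi.single b (A a)) s →
      Good (A + Pi.single a (A b)) s → Good (A + Pi.single b (A a)) (s.erase a) → Good A s)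
    (hbase : ∀ A s, (∀ i ∈ s, 0 ≤ φ (A i)) → Good A s) {M : ℤ} {n : ℕ}
    (IH : ∀ A s, (∀ i ∈ s, |φ (A i)| ≤ M) → (s.filter fun i => |φ (A i)| = M).card < n → Good A s)
    (m : ℕ) : ∀ A s, (∀ i ∈ s, |φ (A i)| ≤ M) → (s.filter fun i => |φ (A i)| = M).card ≤ n →
      ∀ a ∈ s, φ (A a) = M → (s.filter fun i => φ (A i) < 0).card ≤ m → Good A s := by
  induction m with
  | zero =>
    intro A s _ _ _ _ _ h0
    refine hbase A s fun i hi => ?_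
    by_contra hneg
    have : i ∈ s.filter fun i => φ (A i) < 0 := Finset.mem_filter.2 ⟨hi, not_le.1 hneg⟩
    rw [Finset.card_eq_zero.1 (Nat.le_zero.1 h0)] at this
    simp at this
  | succ m ih =>
    intro A s hM hn a ha haM hm
    by_cases hpos : ∀ i ∈ s, 0 ≤ φ (A i)
    · exact hbase A s hpos
    push Not at hpos
    obtain ⟨b, hb, hb0⟩ := hpos
    have hbM := abs_le.1 (hM b hb)
    have hab : a ≠ b := by rintro rfl; omega
    have e1 : ∀ i, φ ((A + Pi.single b (A a) : ι → G) i) = if i = b then M + φ (A b) else φ (A i) := by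
      intro i
      split_ifs with h
      · subst h; simp [haM, add_comm]
      · simp [h]
    have e2 : ∀ i, φ ((A + Pi.single a (A b) : ι → G) i) = if i = a then M + φ (A b) else φ (A i) := by
      intro i
      split_ifs with h
      · subst h; simp [haM]
      · simp [h]
    have hs : |M + φ (A b)| < M := by rw [abs_lt]; omega
    have haf : a ∈ s.filter fun i => |φ (A i)| = M :=
      Finset.mem_filter.2 ⟨ha, by rw [haM, abs_of_nonneg]; omega⟩
    -- Adding `A a` to `A b` removes a negative value; adding `A b` to `A a`, or dropping `a`,
    -- removes a value of modulus `M`. No new value of modulus `M` appears, since `0 ≤ M + φ (A b) <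
    -- M`.
    refine hsplit A s a b hab ha hb ?_ ?_ ?_
    · refine ih _ s ?_ ?_ a ha ?_ ?_
      · intro i hi
        rw [e1]
        split_ifs
        · exact hs.le
        · exact hM i hi
      · refine (Finset.card_le_card ?_).trans hn
        intro i hi
        simp only [Finset.mem_filter, e1] at hi ⊢
        split_ifs at hi
        · omega
        · exact hi
      · rw [e1, if_neg hab, haM]
      · refine Nat.le_of_lt_succ (lt_of_lt_of_le (Finset.card_lt_card ?_) hm)
        refine (Finset.ssubset_iff_of_subset ?_).2 ⟨b, ?_, ?_⟩
        · intro i hi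
          simp only [Finset.mem_filter, e1] at hi ⊢
          split_ifs at hi
          · omega
          · exact hi
        · exact Finset.mem_filter.2 ⟨hb, hb0⟩
        · simp only [Finset.mem_filter, e1, if_true]
          omega
    · refine IH _ s ?_ ?_
      · intro i hi
        rw [e2]
        split_ifs
        · exact hs.le
        · exact hM i hi
      · refine lt_of_lt_of_le (Finset.card_lt_card ?_) hn
        refine (Finset.ssubset_iff_of_subset ?_).2 ⟨a, haf, ?_⟩
        · intro i hi
          simp only [Finset.mem_filter, e2] at hi ⊢
          split_ifs at hi
          · omega
          · exact hi
        · simp only [Finset.mem_filter, e2, if_true]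
          omega
    · refine IH _ _ ?_ ?_
      · intro i hi
        rw [e1]
        split_ifs
        · exact hs.le
        · exact hM i (Finset.mem_of_mem_erase hi)
      · refine lt_of_lt_of_le (Finset.card_lt_card ?_) hn
        refine (Finset.ssubset_iff_of_subset ?_).2 ⟨a, haf, by simp⟩
        intro i hi
        simp only [Finset.mem_filter, e1, Finset.mem_erase] at hi ⊢
        obtain ⟨⟨-, hi⟩, h'⟩ := hi
        split_ifs at h'
        · omega
        · exact ⟨hi, h'⟩

/-- Elliott's reduction as an induction principle: by repeatedly replacing a pair `a, b` of vectors
by `a + b, a`, by `a + b, b` and by `a + b` one arrives at families on which `φ` has one sign. -/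
theorem elliott_induction {φ : G →+ ℤ} {Good : (ι → G) → Finset ι → Prop}
    (hsplit : ∀ A s a b, a ≠ b → a ∈ s → b ∈ s → Good (A + Pi.single b (A a)) s →
      Good (A + Pi.single a (A b)) s → Good (A + Pi.single b (A a)) (s.erase a) → Good A s)
    (hpos : ∀ A s, (∀ i ∈ s, 0 ≤ φ (A i)) → Good A s)
    (hneg : ∀ A s, (∀ i ∈ s, φ (A i) ≤ 0) → Good A s) (A : ι → G) (s : Finset ι) : Good A s := by
  -- Lexicographic induction on a bound `M` for the modulus and on the number of indices attaining
  -- it.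
  have key : ∀ (M n : ℕ) A s, (∀ i ∈ s, |φ (A i)| ≤ M) →
      (s.filter fun i => |φ (A i)| = M).card < n → Good A s := by
    intro M
    induction M with
    | zero =>
      intro n A s h _
      refine hpos A s fun i hi => ?_
      have := h i hi
      simp only [Nat.cast_zero, abs_nonpos_iff] at this
      exact this.ge
    | succ M ihM =>
      intro n
      induction n with
      | zero => intro A s _ h; omega
      | succ n ihn =>
        intro A s hM hn
        by_cases h0 : ∀ i ∈ s, |φ (A i)| ≠ (M + 1 : ℕ)
        · refine ihM _ A s (fun i hi => ?_) (Nat.lt_succ_self _)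
          have h1 := h0 i hi
          have h2 := hM i hi
          omega
        push Not at h0
        obtain ⟨a, ha, haM⟩ := h0
        rcases abs_eq (by positivity) |>.1 haM with h | h
        · exact elliott_aux hsplit hpos ihn _ A s hM (Nat.le_of_lt_succ hn) a ha h le_rfl
        -- An extremal value that is negative becomes positive for `-φ`, with the two one-signed
        -- base cases exchanged.
        · refine elliott_aux (φ := -φ) hsplit (fun A s h => hneg A s fun i hi => ?_)
            (M := (M + 1 : ℕ)) (n := n) (fun A s h h' => ihn A s ?_ ?_) _ A s ?_ ?_ a ha ?_ le_rfl
          · simpa using h i hi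
          · simpa using h
          · simpa using h'
          · simpa using hM
          · simpa using Nat.le_of_lt_succ hn
          · simp [h]
  refine key (s.sup fun i => (φ (A i)).natAbs) _ A s (fun i hi => ?_) (Nat.lt_succ_self _)
  rw [Int.abs_eq_natAbs]
  exact_mod_cast Finset.le_sup (f := fun i => (φ (A i)).natAbs) hi

end Elliott

/-! ### Positive forms and one-signed equations. -/

/-- Some linear form in `K` is positive on all `A i` with `i ∈ s`. -/
def HasPositiveForm {ι G : Type*} [AddCommMonoid G] (K : AddSubgroup (G →+ ℤ)) (A : ι → G)
    (s : Finset ι) : Prop :=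
  ∃ y ∈ K, ∀ i ∈ s, 0 < y (A i)

/-- The vectors of degree `d` on which the forms in `Φ` vanish. -/
def kerOfDegree {G : Type*} [AddCommMonoid G] (Φ : List (G →+ ℤ)) (δ : G →+ ℕ) (d : ℕ) : Set G :=
  {v | (∀ φ ∈ Φ, φ v = 0) ∧ δ v = d}

section PositiveForm

variable {ι G : Type*} [AddCommMonoid G]

theorem HasPositiveForm.mono {K : AddSubgroup (G →+ ℤ)} {A : ι → G} {s t : Finset ι}
    (h : HasPositiveForm K A s) (hts : t ⊆ s) : HasPositiveForm K A t := by
  obtain ⟨y, hy, hpos⟩ := h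
  exact ⟨y, hy, fun i hi => hpos i (hts hi)⟩

theorem hasPositiveForm_of_add_single [DecidableEq ι] {K : AddSubgroup (G →+ ℤ)} {A : ι → G}
    {s : Finset ι} {a b : ι} (ha : a ∈ s) (h : HasPositiveForm K A s) :
    HasPositiveForm K (A + Pi.single b (A a)) s := by
  obtain ⟨y, hy, hpos⟩ := h
  refine ⟨y, hy, fun i hi => ?_⟩
  have h1 := hpos i hi
  have h2 := hpos a ha
  by_cases hib : i = b
  · subst hib
    simp only [Pi.add_apply, Pi.single_eq_same, map_add]
    omega
  · simpa [hib] using h1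

/-- With `T₁` and `T₂` for the two modified families, the original has `T₁ ∧ T₂` and the wall has
`T₁ ∨ T₂`. Hence the indicator of a positive form satisfies the same inclusion–exclusion as the
solution counts. -/
theorem hasPositiveForm_split [DecidableEq ι] (K : AddSubgroup (G →+ ℤ)) (A : ι → G)
    {s : Finset ι} {a b : ι} (hab : a ≠ b) (ha : a ∈ s) (hb : b ∈ s) :
    (HasPositiveForm K A s ↔ HasPositiveForm K (A + Pi.single b (A a)) s ∧
      HasPositiveForm K (A + Pi.single a (A b)) s) ∧
    (HasPositiveForm K (A + Pi.single b (A a)) (s.erase a) ↔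
      HasPositiveForm K (A + Pi.single b (A a)) s ∨
      HasPositiveForm K (A + Pi.single a (A b)) s) := by
  have eb : (A + Pi.single b (A a) : ι → G) b = A b + A a := by simp
  have ea : (A + Pi.single a (A b) : ι → G) a = A a + A b := by simp
  have e1 : ∀ i, i ≠ b → (A + Pi.single b (A a) : ι → G) i = A i := fun i h => by simp [h]
  have e2 : ∀ i, i ≠ a → (A + Pi.single a (A b) : ι → G) i = A i := fun i h => by simp [h]
  constructor
  · refine ⟨fun h => ⟨hasPositiveForm_of_add_single ha h, hasPositiveForm_of_add_single hb h⟩, ?_⟩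
    rintro ⟨⟨u, hu, hu'⟩, ⟨v, hv, hv'⟩⟩
    have u1 := hu' a ha
    have u2 := hu' b hb
    have v1 := hv' a ha
    have v2 := hv' b hb
    rw [e1 a hab] at u1
    rw [eb, map_add] at u2
    rw [ea, map_add] at v1
    rw [e2 b hab.symm] at v2
    -- The weights make the values at `A a` and `A b` equal to `u (A a) * v (A a + A b)` and `v (A
    -- b) * u (A a + A b)`.
    refine ⟨v (A b) • u + u (A a) • v, K.add_mem (K.zsmul_mem hu _) (K.zsmul_mem hv _),
      fun i hi => ?_⟩
    simp only [AddMonoidHom.add_apply, AddMonoidHom.smul_apply, smul_eq_mul]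
    by_cases hia : i = a
    · subst hia; nlinarith
    by_cases hib : i = b
    · subst hib; nlinarith
    have u3 := hu' i hi
    have v3 := hv' i hi
    rw [e1 i hib] at u3
    rw [e2 i hia] at v3
    positivity
  · constructor
    · rintro ⟨y, hy, hpos⟩
      have h1 := hpos b (Finset.mem_erase.2 ⟨hab.symm, hb⟩)
      rw [eb, map_add] at h1
      rcases lt_or_ge 0 (y (A a)) with h | h
      · refine Or.inl ⟨y, hy, fun i hi => ?_⟩
        by_cases hia : i = a
        · rwa [hia, e1 a hab]
        · exact hpos i (Finset.mem_erase.2 ⟨hia, hi⟩)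
      · refine Or.inr ⟨y, hy, fun i hi => ?_⟩
        by_cases hia : i = a
        · rw [hia, ea, map_add]; omega
        rw [e2 i hia]
        by_cases hib : i = b
        · rw [hib]; omega
        · rw [← e1 i hib]
          exact hpos i (Finset.mem_erase.2 ⟨hia, hi⟩)
    · rintro (h | ⟨y, hy, hpos⟩)
      · exact h.mono (Finset.erase_subset _ _)
      · refine ⟨y, hy, fun i hi => ?_⟩
        obtain ⟨hia, hi⟩ := Finset.mem_erase.1 hi
        by_cases hib : i = b
        · have := hpos a ha
          rw [ea, map_add] at this
          rw [hib, eb, map_add]; omega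
        · rw [e1 i hib, ← e2 i hia]
          exact hpos i hi

/-- A large multiple of `ε • φ` makes any form positive where `ε * φ` is positive, so only the
vectors killed by `φ` impose a condition; on those, multiples of `φ` are invisible. -/
theorem hasPositiveForm_insert_iff (Φ : Set (G →+ ℤ)) {φ : G →+ ℤ} {A : ι → G} {s : Finset ι}
    {ε : ℤ} (hε : ε ≠ 0) (h : ∀ i ∈ s, 0 ≤ ε * φ (A i)) :
    HasPositiveForm (AddSubgroup.closure (insert φ Φ)) A s ↔
      HasPositiveForm (AddSubgroup.closure Φ) A (s.filter fun i => ε * φ (A i) = 0) := by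
  constructor
  · rintro ⟨y, hy, hpos⟩
    rw [Set.insert_eq, AddSubgroup.closure_union, AddSubgroup.mem_sup] at hy
    obtain ⟨u, hu, v, hv, rfl⟩ := hy
    obtain ⟨n, rfl⟩ := AddSubgroup.mem_closure_singleton.1 hu
    refine ⟨v, hv, fun i hi => ?_⟩
    obtain ⟨his, hi0⟩ := Finset.mem_filter.1 hi
    have := hpos i his
    simpa [(mul_eq_zero.1 hi0).resolve_left hε] using this
  · rintro ⟨y, hy, hpos⟩
    set M : ℤ := 1 + ∑ i ∈ s, |y (A i)| with hM
    refine ⟨y + (M * ε) • φ, add_mem (AddSubgroup.closure_mono (Set.subset_insert _ _) hy)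
      (zsmul_mem (AddSubgroup.subset_closure (Set.mem_insert _ _)) _), fun i hi => ?_⟩
    simp only [AddMonoidHom.add_apply, AddMonoidHom.smul_apply, smul_eq_mul, mul_assoc]
    rcases (h i hi).eq_or_lt with h0 | h0
    · rw [← h0, mul_zero, add_zero]
      exact hpos i (Finset.mem_filter.2 ⟨hi, h0.symm⟩)
    · have h1 : |y (A i)| ≤ ∑ i ∈ s, |y (A i)| :=
        Finset.single_le_sum (f := fun i => |y (A i)|) (fun _ _ => abs_nonneg _) hi
      have h2 := neg_abs_le (y (A i))
      have h3 := abs_nonneg (y (A i))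
      nlinarith

/-- A sum of non-negative terms vanishes only termwise, so a one-signed equation just restricts the
support. -/
theorem coneSols_cons_eq [Fintype ι] (Φ : List (G →+ ℤ)) {φ : G →+ ℤ} {A : ι → G} {s : Finset ι}
    (δ : G →+ ℕ) (d : ℕ) {ε : ℤ} (hε : ε ≠ 0) (h : ∀ i ∈ s, 0 ≤ ε * φ (A i)) :
    coneSols (kerOfDegree (φ :: Φ) δ d) A s =
      coneSols (kerOfDegree Φ δ d) A (s.filter fun i => ε * φ (A i) = 0) := by
  have hsum : ∀ c : ι → ℕ, φ (∑ i, c i • A i) = ∑ i, c i * φ (A i) := fun c => by simp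
  ext c
  constructor
  · rintro ⟨h1, h2, h3⟩
    refine ⟨fun i hi => ?_, fun ψ hψ => h2 ψ (List.mem_cons_of_mem _ hψ), h3⟩
    by_cases his : i ∈ s
    · have h4 : ∑ i, (c i : ℤ) * (ε * φ (A i)) = 0 := by
        have := h2 φ List.mem_cons_self
        rw [hsum] at this
        rw [← mul_zero ε, ← this, Finset.mul_sum]
        exact Finset.sum_congr rfl fun i _ => by ring
      rw [Finset.sum_eq_zero_iff_of_nonneg] at h4
      · have := h4 i (Finset.mem_univ _)
        rcases mul_eq_zero.1 this with h5 | h5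
        · exact_mod_cast h5
        · exact absurd (Finset.mem_filter.2 ⟨his, h5⟩) hi
      · intro j _
        by_cases hj : j ∈ s
        · exact mul_nonneg (by positivity) (h j hj)
        · simp [h1 j hj]
    · exact h1 i his
  · rintro ⟨h1, h2, h3⟩
    refine ⟨fun i hi => h1 i fun h => hi (Finset.mem_filter.1 h).1, ?_, h3⟩
    intro ψ hψ
    rcases List.mem_cons.1 hψ with rfl | hψ
    · rw [hsum]
      refine Finset.sum_eq_zero fun i _ => ?_
      by_cases hi : i ∈ s.filter fun i => ε * ψ (A i) = 0
      · have := (Finset.mem_filter.1 hi).2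
        rcases mul_eq_zero.1 this with h5 | h5
        · exact absurd h5 hε
        · rw [h5, mul_zero]
      · simp [h1 i hi]
    · exact h2 ψ hψ

end PositiveForm

/-! ### Counting solutions by degree. -/

section Counting

variable {ι G : Type*} [Fintype ι] [DecidableEq ι] [AddCommMonoid G]

/-- Either `c a` is zero, or one copy of `A a` can be removed, lowering the degree by `δ (A a)`. -/
theorem coneSols_degree_insert_ncard {δ : G →+ ℕ} {A : ι → G} {s : Finset ι} {a : ι} (ha : a ∉ s)
    (d : ℕ) (hfin : (coneSols (kerOfDegree [] δ (d + δ (A a))) A (insert a s)).Finite) :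
    (coneSols (kerOfDegree [] δ (d + δ (A a))) A (insert a s)).ncard =
      (coneSols (kerOfDegree [] δ d) A (insert a s)).ncard +
      (coneSols (kerOfDegree [] δ (d + δ (A a))) A s).ncard := by
  have hinj : Function.Injective fun c : ι → ℕ => c + Pi.single a 1 := add_left_injective _
  have hdeg : ∀ c : ι → ℕ,
      δ (∑ i, (c + Pi.single a 1 : ι → ℕ) i • A i) = δ (∑ i, c i • A i) + δ (A a) := by
    intro c
    simp only [Pi.add_apply, add_smul, Finset.sum_add_distrib, map_add]
    congr 2
    rw [Finset.sum_eq_single a] <;> simp +contextual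
  have himg : (fun c : ι → ℕ => c + Pi.single a 1) ''
      coneSols (kerOfDegree [] δ d) A (insert a s) =
      {c | c ∈ coneSols (kerOfDegree [] δ (d + δ (A a))) A (insert a s) ∧ c a ≠ 0} := by
    ext c
    constructor
    · rintro ⟨c, ⟨h1, -, h2⟩, rfl⟩
      refine ⟨⟨fun i hi => ?_, by simp, ?_⟩, by simp⟩
      · have : i ≠ a := fun h => hi (h ▸ Finset.mem_insert_self _ _)
        simp [this, h1 i hi]
      · rw [hdeg, h2]
    · rintro ⟨⟨h1, -, h2⟩, h3⟩
      have key : c - Pi.single a 1 + Pi.single a 1 = c := by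
        funext i
        by_cases hi : i = a
        · subst hi; simp only [Pi.add_apply, Pi.sub_apply, Pi.single_eq_same]; omega
        · simp [hi]
      refine ⟨c - Pi.single a 1, ⟨fun i hi => by simp [h1 i hi], by simp, ?_⟩, key⟩
      have := hdeg (c - Pi.single a 1)
      rw [key, h2] at this
      omega
  have hzero : coneSols (kerOfDegree [] δ (d + δ (A a))) A s =
      {c | c ∈ coneSols (kerOfDegree [] δ (d + δ (A a))) A (insert a s) ∧ c a = 0} := by
    ext c
    constructor
    · rintro ⟨h1, h2⟩
      exact ⟨⟨fun i hi => h1 i fun h => hi (Finset.mem_insert_of_mem h), h2⟩, h1 a ha⟩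
    · rintro ⟨⟨h1, h2⟩, h3⟩
      refine ⟨fun i hi => ?_, h2⟩
      by_cases hia : i = a
      · rw [hia, h3]
      · exact h1 i (by simp [hia, hi])
  rw [← Set.ncard_image_of_injective (coneSols (kerOfDegree [] δ d) A (insert a s)) hinj, himg,
    hzero, ← Set.ncard_union_eq (Set.disjoint_left.2 fun c h h' => h.2 h'.2)
      (hfin.subset fun c h => h.1) (hfin.subset fun c h => h.1)]
  congr 1
  ext c
  exact ⟨fun h => (ne_or_eq (c a) 0).imp (fun h' => ⟨h, h'⟩) fun h' => ⟨h, h'⟩,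
    fun h => h.elim And.left And.left⟩

/-- Adjoining a vector is a summation with step `δ (A a)`, by the preceding recursion. The empty
family has one solution, in degree 0; this is the origin of the correction term. -/
theorem isQuasiPoly_degree_count {δ : G →+ ℕ} {A : ι → G} (s : Finset ι)
    (hfin : ∀ d, (coneSols (kerOfDegree [] δ d) A s).Finite) :
    IsQuasiPoly fun d => ((coneSols (kerOfDegree [] δ d) A s).ncard : ℚ) -
      if s = ∅ ∧ d = 0 then 1 else 0 := by
  induction s using Finset.induction_on with
  | empty =>
    convert IsQuasiPoly.const 0 using 2 with d
    have h : ∀ c : ι → ℕ, (∀ i, i ∉ (∅ : Finset ι) → c i = 0) ↔ c = 0 := fun c => by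
      simp [funext_iff]
    by_cases hd : d = 0
    · have : coneSols (kerOfDegree [] δ d) A ∅ = {0} := by
        ext c
        simp only [coneSols, kerOfDegree, Set.mem_ofPred_eq, h, Set.mem_singleton_iff]
        refine ⟨fun h => h.1, fun h => ⟨h, by simp [h, hd]⟩⟩
      rw [this, if_pos ⟨rfl, hd⟩]
      simp
    · have : coneSols (kerOfDegree [] δ d) A ∅ = ∅ := by
        ext c
        simp only [coneSols, kerOfDegree, Set.mem_ofPred_eq, h, Set.mem_empty_iff_false, iff_false]
        rintro ⟨rfl, h⟩
        simp [Ne.symm hd] at h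
      simp [this, hd]
  | insert a s ha ih =>
    -- If `A a` had degree 0, all its multiples would be solutions of degree 0.
    have hpos : 0 < δ (A a) := by
      by_contra h0
      have h0 : δ (A a) = 0 := by omega
      refine (Set.infinite_of_injective_forall_mem (f := fun n : ℕ => (Pi.single a n : ι → ℕ))
        (fun m n h => by simpa using congrFun h a) fun n => ?_) (hfin 0)
      refine ⟨fun i hi => ?_, by simp, ?_⟩
      · have : i ≠ a := fun h => hi (h ▸ Finset.mem_insert_self _ _)
        simp [this]
      · rw [Finset.sum_eq_single a] <;> simp +contextual [h0]
    have ih' := (ih fun d => (hfin d).subset fun c h =>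
      ⟨fun i hi => h.1 i fun h => hi (Finset.mem_insert_of_mem h), h.2⟩).shift (δ (A a))
    refine IsQuasiPoly.of_sub hpos ?_
    convert ih' using 2 with d
    rw [coneSols_degree_insert_ncard ha d (hfin _)]
    rw [if_neg (by simp), if_neg (by simp), if_neg (by simp [hpos.ne'])]
    push_cast
    ring

open Classical in
/-- The number of solutions of degree `d` of a system of homogeneous linear equations is a
quasi-polynomial in `d`, up to a correction at `d = 0` if there is a positive form. -/
theorem isQuasiPoly_coneSols {δ : G →+ ℕ} (Φ : List (G →+ ℤ)) : ∀ (A : ι → G) (s : Finset ι),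
    (∀ d, (coneSols (kerOfDegree Φ δ d) A s).Finite) →
    IsQuasiPoly fun d => ((coneSols (kerOfDegree Φ δ d) A s).ncard : ℚ) -
      if HasPositiveForm (AddSubgroup.closure {φ | φ ∈ Φ}) A s ∧ d = 0 then 1 else 0 := by
  induction Φ with
  | nil =>
    intro A s hfin
    have : HasPositiveForm (AddSubgroup.closure {φ | φ ∈ ([] : List (G →+ ℤ))}) A s ↔ s = ∅ := by
      simp only [HasPositiveForm, List.not_mem_nil, Set.ofPred_false, AddSubgroup.closure_empty,
        AddSubgroup.mem_bot, exists_eq_left, AddMonoidHom.zero_apply, lt_irrefl]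
      exact Finset.eq_empty_iff_forall_notMem.symm
    simp only [this]
    exact isQuasiPoly_degree_count s hfin
  | cons φ Φ ih =>
    have hcons : {ψ | ψ ∈ φ :: Φ} = insert φ {ψ | ψ ∈ Φ} := by ext; simp
    -- For an equation of one sign, both the count and the correction term reduce to the remaining
    -- equations on the smaller support.
    have hbase : ∀ ε : ℤ, ε ≠ 0 → ∀ (A : ι → G) (s : Finset ι), (∀ i ∈ s, 0 ≤ ε * φ (A i)) →
        (∀ d, (coneSols (kerOfDegree (φ :: Φ) δ d) A s).Finite) →
        IsQuasiPoly fun d => ((coneSols (kerOfDegree (φ :: Φ) δ d) A s).ncard : ℚ) -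
        if HasPositiveForm (AddSubgroup.closure {ψ | ψ ∈ φ :: Φ}) A s ∧ d = 0 then 1 else 0 := by
      intro ε hε A s h hfin
      simp only [hcons, hasPositiveForm_insert_iff _ hε h, coneSols_cons_eq _ _ _ hε h] at hfin ⊢
      exact ih _ _ hfin
    refine elliott_induction (φ := φ) ?_
      (fun A s h => hbase 1 one_ne_zero A s fun i hi => by simpa using h i hi)
      (fun A s h => hbase (-1) (by decide) A s fun i hi => by simpa using h i hi)
    intro A s a b hab ha hb h1 h2 h3 hfin
    have h1 := h1 fun d => finite_coneSols_add_single hab ha (hfin d)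
    have h2 := h2 fun d => finite_coneSols_add_single hab.symm hb (hfin d)
    have h3 := h3 fun d => finite_coneSols_erase (finite_coneSols_add_single hab ha (hfin d))
    convert (h1.add h2).sub h3 using 2 with d
    have hN := ncard_coneSols_split hab ha hb (hfin d)
    have hN : ((coneSols (kerOfDegree (φ :: Φ) δ d) A s).ncard : ℚ) =
      (coneSols (kerOfDegree (φ :: Φ) δ d) (A + Pi.single b (A a)) s).ncard +
      (coneSols (kerOfDegree (φ :: Φ) δ d) (A + Pi.single a (A b)) s).ncard -
      (coneSols (kerOfDegree (φ :: Φ) δ d) (A + Pi.single b (A a)) (s.erase a)).ncard := by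
      rw [eq_sub_iff_add_eq]
      exact_mod_cast hN
    obtain ⟨e1, e2⟩ := hasPositiveForm_split (AddSubgroup.closure {ψ | ψ ∈ φ :: Φ}) A hab ha hb
    have hT : ∀ T₁ T₂ : Prop, (if (T₁ ∧ T₂) ∧ d = 0 then (1 : ℚ) else 0) =
        (if T₁ ∧ d = 0 then 1 else 0) + (if T₂ ∧ d = 0 then 1 else 0) -
        if (T₁ ∨ T₂) ∧ d = 0 then 1 else 0 := by
      intro T₁ T₂
      by_cases t1 : T₁ <;> by_cases t2 : T₂ <;> by_cases t3 : d = 0 <;> simp [t1, t2, t3]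
    rw [hN]
    simp only [e1, e2, hT]
    ring

/-- A form in the span of `Φ` vanishes on `∑ i, c i • A i` for every solution `c`. If it were
positive on the `A i`, this would force `c = 0`, which has degree 0; so a solution of positive
degree excludes the correction. -/
theorem isQuasiPoly_coneSols_of_exists {δ : G →+ ℕ} {Φ : List (G →+ ℤ)} {A : ι → G} {s : Finset ι}
    (hfin : ∀ d, (coneSols (kerOfDegree Φ δ d) A s).Finite) {d₀ : ℕ} (hd₀ : 0 < d₀)
    (hne : (coneSols (kerOfDegree Φ δ d₀) A s).Nonempty) :
    IsQuasiPoly fun d => ((coneSols (kerOfDegree Φ δ d) A s).ncard : ℚ) := by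
  have h : ¬ HasPositiveForm (AddSubgroup.closure {φ | φ ∈ Φ}) A s := by
    rintro ⟨y, hy, hpos⟩
    obtain ⟨c, h1, h2, h3⟩ := hne
    have hy0 : y (∑ i, c i • A i) = 0 := by
      clear hpos
      induction hy using AddSubgroup.closure_induction with
      | mem ψ hψ => exact h2 ψ hψ
      | zero => rfl
      | add u v _ _ hu hv => simp [-map_sum, hu, hv]
      | neg u _ hu => simp [-map_sum, hu]
    have hy1 : ∑ i, (c i : ℤ) * y (A i) = 0 := by simpa using hy0
    have hnn : ∀ i ∈ Finset.univ, 0 ≤ (c i : ℤ) * y (A i) := by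
      intro i _
      by_cases hi : i ∈ s
      · exact mul_nonneg (by positivity) (hpos i hi).le
      · simp [h1 i hi]
    rw [Finset.sum_eq_zero_iff_of_nonneg hnn] at hy1
    have hc : ∀ i, c i = 0 := by
      intro i
      by_cases hi : i ∈ s
      · exact_mod_cast (mul_eq_zero.1 (hy1 i (Finset.mem_univ _))).resolve_right (hpos i hi).ne'
      · exact h1 i hi
    simp only [hc, zero_smul, Finset.sum_const_zero, map_zero] at h3
    omega
  simpa [h] using isQuasiPoly_coneSols (δ := δ) Φ A s hfin

end Counting

/-! ### Ehrhart's theorem via slack variables. -/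

section Ehrhart

variable {ι κ : Type*} [Fintype ι] [Fintype κ] [DecidableEq κ]

/-- The generators of the cone over the polytope `0 ≤ b f + ∑ a f i * x i` with slack variables. -/
def slackGenerator (b : κ → ℤ) (a : κ → ι → ℤ) : Option (ι ⊕ κ) → ℕ × (κ → ℤ)
  | none => (1, b)
  | some (Sum.inl i) => (0, fun f => a f i)
  | some (Sum.inr f) => (0, Pi.single f (-1))

theorem sum_slackGenerator_fst (b : κ → ℤ) (a : κ → ι → ℤ) (c : Option (ι ⊕ κ) → ℕ) :
    (∑ j, c j • slackGenerator b a j).1 = c none := by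
  simp [Prod.fst_sum, slackGenerator]

theorem sum_slackGenerator_snd (b : κ → ℤ) (a : κ → ι → ℤ) (c : Option (ι ⊕ κ) → ℕ) (f : κ) :
    (∑ j, c j • slackGenerator b a j).2 f =
      b f * c none + ∑ i, a f i * c (some (Sum.inl i)) - c (some (Sum.inr f)) := by
  have h : (∑ j, c j • slackGenerator b a j).2 f = ∑ j, (c j : ℤ) * (slackGenerator b a j).2 f := by
    simp [Prod.snd_sum]
  rw [h]
  simp [Fintype.sum_option, Fintype.sum_sum_type, slackGenerator, Pi.single_apply, mul_comm]
  ring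

/-- **Ehrhart's theorem** in the form of a homogeneous system of linear inequalities. -/
theorem isQuasiPoly_inequalities (b : κ → ℤ) (a : κ → ι → ℤ)
    (hfin : ∀ d : ℕ, {x : ι → ℕ | ∀ f, 0 ≤ b f * d + ∑ i, a f i * x i}.Finite)
    (hne : ∃ x : ι → ℕ, ∀ f, 0 ≤ b f + ∑ i, a f i * x i) :
    IsQuasiPoly fun d => ({x : ι → ℕ | ∀ f, 0 ≤ b f * d + ∑ i, a f i * x i}.ncard : ℚ) := by
  classical
  set Φ : List (ℕ × (κ → ℤ) →+ ℤ) := Finset.univ.toList.map fun f =>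
    (Pi.evalAddMonoidHom (fun _ : κ => ℤ) f).comp (AddMonoidHom.snd ℕ (κ → ℤ)) with hΦ
  set δ : ℕ × (κ → ℤ) →+ ℕ := AddMonoidHom.fst ℕ (κ → ℤ) with hδ
  have hmem : ∀ d c, c ∈ coneSols (kerOfDegree Φ δ d) (slackGenerator b a) Finset.univ ↔
      c none = d ∧ ∀ f, (c (some (Sum.inr f)) : ℤ) =
        b f * d + ∑ i, a f i * c (some (Sum.inl i)) := by
    intro d c
    simp only [coneSols, kerOfDegree, Set.mem_ofPred_eq, Finset.mem_univ, not_true_eq_false,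
      false_imp_iff, implies_true, true_and, hΦ, hδ, List.mem_map, Finset.mem_toList,
      forall_exists_index, forall_apply_eq_imp_iff, AddMonoidHom.comp_apply,
      AddMonoidHom.coe_snd, AddMonoidHom.coe_fst, Pi.evalAddMonoidHom_apply,
      sum_slackGenerator_fst, sum_slackGenerator_snd]
    rw [and_comm]
    refine and_congr_right fun hc => forall_congr' fun f => ?_
    rw [hc]
    constructor <;> intro h <;> linarith
  set r : (Option (ι ⊕ κ) → ℕ) → ι → ℕ := fun c i => c (some (Sum.inl i)) with hr
  -- The equations determine the slack variables from `d` and `x`, so forgetting them loses nothing.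
  have hinj : ∀ d, Set.InjOn r
      (coneSols (kerOfDegree Φ δ d) (slackGenerator b a) Finset.univ) := by
    intro d c hc c' hc' h
    obtain ⟨h1, h2⟩ := (hmem d c).1 hc
    obtain ⟨h1', h2'⟩ := (hmem d c').1 hc'
    have h3 : ∀ i, c (some (Sum.inl i)) = c' (some (Sum.inl i)) := fun i => congrFun h i
    funext j
    match j with
    | none => rw [h1, h1']
    | some (Sum.inl i) => exact h3 i
    | some (Sum.inr f) =>
      have := h2 f
      simp only [h3, ← h2' f] at this
      exact_mod_cast this
  have himg : ∀ d, r '' coneSols (kerOfDegree Φ δ d) (slackGenerator b a) Finset.univ =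
      {x : ι → ℕ | ∀ f, 0 ≤ b f * d + ∑ i, a f i * x i} := by
    intro d
    ext x
    constructor
    · rintro ⟨c, hc, rfl⟩ f
      rw [hr, ← ((hmem d c).1 hc).2 f]
      positivity
    · intro hx
      refine ⟨fun j => match j with
        | none => d
        | some (Sum.inl i) => x i
        | some (Sum.inr f) => (b f * d + ∑ i, a f i * x i).toNat, (hmem d _).2 ⟨rfl, fun f => ?_⟩,
        rfl⟩
      exact Int.toNat_of_nonneg (hx f)
  simp only [← himg, (hinj _).ncard_image]
  refine isQuasiPoly_coneSols_of_exists (fun d => ?_) one_pos ?_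
  · refine Set.Finite.of_finite_image ?_ (hinj d)
    rw [himg]
    exact hfin d
  · obtain ⟨x, hx⟩ := hne
    rw [← Set.image_nonempty (f := r), himg]
    exact ⟨x, fun f => by simpa using hx f⟩

end Ehrhart

/-! ### A calculus of homogeneous linear systems. -/

/-- The predicate `S d x` is a finite system of linear inequalities homogeneous in `(d, x)`. -/
def IsLinearSystem {ι : Type*} [Fintype ι] (S : ℕ → (ι → ℕ) → Prop) : Prop :=
  ∃ F : List (ℤ × (ι → ℤ)), ∀ d x, S d x ↔ ∀ f ∈ F, 0 ≤ f.1 * d + ∑ i, f.2 i * x i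

namespace IsLinearSystem

variable {ι : Type*} [Fintype ι]

theorem and {S T : ℕ → (ι → ℕ) → Prop} (hS : IsLinearSystem S) (hT : IsLinearSystem T) :
    IsLinearSystem fun d x => S d x ∧ T d x := by
  obtain ⟨F, hF⟩ := hS
  obtain ⟨H, hH⟩ := hT
  refine ⟨F ++ H, fun d x => ?_⟩
  simp only [hF, hH, List.mem_append, or_imp, forall_and]

theorem forall_fin {n : ℕ} {S : Fin n → ℕ → (ι → ℕ) → Prop} (h : ∀ j, IsLinearSystem (S j)) :
    IsLinearSystem fun d x => ∀ j, S j d x := by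
  choose F hF using h
  refine ⟨(List.finRange n).flatMap F, fun d x => ?_⟩
  simp only [List.mem_flatMap, List.mem_finRange, true_and, forall_exists_index, hF]
  exact forall_comm

theorem of_imp {S : ℕ → (ι → ℕ) → Prop} (p : Prop) (h : p → IsLinearSystem S) :
    IsLinearSystem fun d x => p → S d x := by
  by_cases hp : p
  · simpa only [hp, forall_const] using h hp
  · exact ⟨[], by simp [hp]⟩

/-- An expression that is an integral linear form in `(d, x)`. -/
def IsForm (l : ℕ → (ι → ℕ) → ℕ) : Prop :=
  ∃ f : ℤ × (ι → ℤ), ∀ d x, (l d x : ℤ) = f.1 * d + ∑ i, f.2 i * x i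

theorem isForm_coord (i : ι) : IsForm fun _ (x : ι → ℕ) => x i := by
  classical
  exact ⟨(0, Pi.single i 1), fun d x => by simp [Pi.single_apply]⟩

theorem isForm_mul (b : ℕ) : IsForm fun d (_ : ι → ℕ) => d * b :=
  ⟨(b, 0), fun d x => by simp [mul_comm]⟩

theorem isForm_sum {n : ℕ} {l : Fin n → ℕ → (ι → ℕ) → ℕ} (h : ∀ j, IsForm (l j)) :
    IsForm fun d x => ∑ j, l j d x := by
  choose f hf using h
  refine ⟨(∑ j, (f j).1, fun i => ∑ j, (f j).2 i), fun d x => ?_⟩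
  simp only [Nat.cast_sum, hf, Finset.sum_add_distrib, Finset.sum_mul]
  rw [Finset.sum_comm]

theorem le {l l' : ℕ → (ι → ℕ) → ℕ} (h : IsForm l) (h' : IsForm l') :
    IsLinearSystem fun d x => l d x ≤ l' d x := by
  obtain ⟨f, hf⟩ := h
  obtain ⟨f', hf'⟩ := h'
  refine ⟨[f' - f], fun d x => ?_⟩
  have h1 := hf d x
  have h2 := hf' d x
  simp only [List.mem_singleton, forall_eq, Prod.fst_sub, Prod.snd_sub, Pi.sub_apply, sub_mul,
    Finset.sum_sub_distrib]
  omega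

theorem eq {l l' : ℕ → (ι → ℕ) → ℕ} (h : IsForm l) (h' : IsForm l') :
    IsLinearSystem fun d x => l d x = l' d x := by
  simpa only [le_antisymm_iff] using (le h h').and (le h' h)

theorem isQuasiPoly {S : ℕ → (ι → ℕ) → Prop} (hS : IsLinearSystem S)
    (hfin : ∀ d, {x | S d x}.Finite) (hne : ∃ x, S 1 x) :
    IsQuasiPoly fun d => ({x | S d x}.ncard : ℚ) := by
  obtain ⟨F, hF⟩ := hS
  have h : ∀ d x, S d x ↔
      ∀ j : Fin F.length, 0 ≤ (F.get j).1 * (d : ℤ) + ∑ i, (F.get j).2 i * (x i : ℤ) := by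
    intro d x
    rw [hF, List.forall_mem_iff_get]
  simp only [h] at hfin hne ⊢
  exact isQuasiPoly_inequalities _ _ hfin (by simpa using hne)

end IsLinearSystem

/-! ### Tableaux as Gelfand–Tsetlin patterns. -/

/-- Gelfand–Tsetlin patterns with top row `l` and all weights equal to `k`: the `j`-th row `x j` is
padded with zeros, and the rows from the `p`-th on are equal to `l`. -/
structure IsGTPattern (p k : ℕ) (l : ℕ → ℕ) (x : ℕ → ℕ → ℕ) : Prop where
  zero : ∀ i, x 0 i = 0
  top : ∀ j, p ≤ j → ∀ i, x j i = l i
  mono : ∀ j i, x j i ≤ x (j + 1) i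
  inter : ∀ j i, x (j + 1) (i + 1) ≤ x j i
  sum : ∀ j ≤ p, ∑ i ∈ Finset.range p, x j i = j * k

theorem Finset.mem_iff_lt_card_of_isLowerSet {S : Finset ℕ} (h : ∀ c ∈ S, ∀ c' < c, c' ∈ S)
    (c : ℕ) : c ∈ S ↔ c < S.card := by
  constructor
  · intro hc
    have : Finset.range (c + 1) ⊆ S := fun c' hc' => by
      rcases Nat.lt_succ_iff_lt_or_eq.1 (Finset.mem_range.1 hc') with h' | rfl
      · exact h c hc c' h'
      · exact hc
    simpa using Finset.card_le_card this
  · intro hlt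
    by_contra hc
    have : S ⊆ Finset.range c := fun c' hc' => by
      rw [Finset.mem_range]
      by_contra hle
      rcases (not_lt.1 hle).eq_or_lt with rfl | h'
      · exact hc hc'
      · exact hc (h c' hc' c h')
    have := Finset.card_le_card this
    rw [Finset.card_range] at this
    omega

theorem YoungDiagram.sum_card_filter_row (μ : YoungDiagram) {p : ℕ}
    (hp : ∀ i, p ≤ i → μ.rowLen i = 0) (Q : ℕ → ℕ → Prop) [∀ i, DecidablePred (Q i)] :
    ∑ i ∈ Finset.range p, ((Finset.range (μ.rowLen i)).filter (Q i)).card =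
      (μ.cells.filter fun x => Q x.1 x.2).card := by
  rw [Finset.card_eq_sum_card_fiberwise (f := Prod.fst) (t := Finset.range p)]
  · refine Finset.sum_congr rfl fun i _ => ?_
    refine Finset.card_bij (fun c _ => (i, c)) ?_ ?_ ?_
    · intro c hc
      simp only [Finset.mem_filter, Finset.mem_range] at hc
      simp only [Finset.mem_filter, YoungDiagram.mem_cells, YoungDiagram.mem_iff_lt_rowLen]
      exact ⟨hc, trivial⟩
    · intro c _ c' _ h
      exact congrArg Prod.snd h
    · rintro ⟨i', c⟩ h
      simp only [Finset.mem_filter, YoungDiagram.mem_cells, YoungDiagram.mem_iff_lt_rowLen] at h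
      obtain ⟨h, rfl⟩ := h
      exact ⟨c, by simpa using h, rfl⟩
  · rintro ⟨i, c⟩ h
    simp only [Finset.coe_filter, Set.mem_ofPred_eq, YoungDiagram.mem_cells,
      YoungDiagram.mem_iff_lt_rowLen] at h
    simp only [Finset.coe_range, Set.mem_Iio]
    by_contra hi
    rw [hp i (not_lt.1 hi)] at h
    omega

theorem YoungDiagram.sum_rowLen (μ : YoungDiagram) {p : ℕ} (hp : ∀ i, p ≤ i → μ.rowLen i = 0) :
    ∑ i ∈ Finset.range p, μ.rowLen i = μ.card := by
  simpa using μ.sum_card_filter_row hp fun _ _ => True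

theorem YoungDiagram.rowLen_eq_zero_of_colLen_le {μ : YoungDiagram} {p : ℕ} (h : μ.colLen 0 ≤ p)
    (i : ℕ) (hi : p ≤ i) : μ.rowLen i = 0 := by
  by_contra h0
  have := YoungDiagram.mem_iff_lt_colLen.1
    (YoungDiagram.mem_iff_lt_rowLen.2 (Nat.pos_of_ne_zero h0))
  omega

namespace SemistandardYoungTableau

variable {μ : YoungDiagram}

/-- The number of entries `≤ j` in row `i`. -/
def rowCount (T : SemistandardYoungTableau μ) (j i : ℕ) : ℕ :=
  ((Finset.range (μ.rowLen i)).filter fun c => T i c ≤ j).card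

/-- Rows increase weakly, so the entries at most `j` form an initial segment of the row. -/
theorem le_iff_lt_rowCount (T : SemistandardYoungTableau μ) {i c : ℕ} (hc : c < μ.rowLen i)
    (j : ℕ) : T i c ≤ j ↔ c < T.rowCount j i := by
  rw [rowCount, ← Finset.mem_iff_lt_card_of_isLowerSet]
  · simp [hc]
  · intro c hc c' hlt
    simp only [Finset.mem_filter, Finset.mem_range] at hc ⊢
    exact ⟨hlt.trans hc.1,
      (T.row_weak hlt (YoungDiagram.mem_iff_lt_rowLen.2 hc.1)).trans hc.2⟩

theorem sum_rowCount (T : SemistandardYoungTableau μ) {p : ℕ} (hp : ∀ i, p ≤ i → μ.rowLen i = 0)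
    (j : ℕ) : ∑ i ∈ Finset.range p, T.rowCount j i =
      (μ.cells.filter fun x => T x.1 x.2 ≤ j).card :=
  μ.sum_card_filter_row hp fun i c => T i c ≤ j

theorem card_filter_le_succ (T : SemistandardYoungTableau μ) (j : ℕ) :
    (μ.cells.filter fun x => T x.1 x.2 ≤ j + 1).card =
      (μ.cells.filter fun x => T x.1 x.2 ≤ j).card +
      (μ.cells.filter fun x => T x.1 x.2 = j + 1).card := by
  rw [← Finset.card_union_of_disjoint]
  · congr 1
    ext x
    simp only [Finset.mem_filter, Finset.mem_union, ← and_or_left]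
    refine and_congr_right fun _ => ?_
    omega
  · rw [Finset.disjoint_left]
    intro x h h'
    have h1 := (Finset.mem_filter.1 h).2
    have h2 := (Finset.mem_filter.1 h').2
    omega

/-- Monotonicity and interlacing hold for every tableau, the latter by strictness of columns. The
content is encoded in the rest: successive row sums of the pattern differ by the number of entries
equal to `j + 1`, while `zero` and `top` exclude entries outside `1, …, p`. -/
theorem hasContent_iff_isGTPattern (T : SemistandardYoungTableau μ) {p : ℕ} (k : ℕ)
    (hp : ∀ i, p ≤ i → μ.rowLen i = 0) :
    T.HasContent p k ↔ IsGTPattern p k μ.rowLen T.rowCount := by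
  constructor
  · intro h
    have hmem : ∀ i c, c < μ.rowLen i → 1 ≤ T i c ∧ T i c ≤ p := by
      intro i c hc
      by_contra hn
      have := h (T i c)
      rw [if_neg (by simpa using hn), Finset.card_eq_zero] at this
      refine Finset.notMem_empty (i, c) (this ▸ Finset.mem_filter.2 ⟨?_, rfl⟩)
      rwa [YoungDiagram.mem_cells, YoungDiagram.mem_iff_lt_rowLen]
    have hzero : ∀ i, T.rowCount 0 i = 0 := by
      intro i
      rw [rowCount, Finset.card_eq_zero, Finset.filter_eq_empty_iff]
      intro c hc
      have := (hmem i c (Finset.mem_range.1 hc)).1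
      omega
    refine ⟨hzero, ?_, ?_, ?_, ?_⟩
    · intro j hj i
      rw [rowCount, Finset.filter_true_of_mem, Finset.card_range]
      exact fun c hc => (hmem i c (Finset.mem_range.1 hc)).2.trans hj
    · intro j i
      exact Finset.card_le_card (Finset.monotone_filter_right _ fun c _ hc => Nat.le_succ_of_le hc)
    · intro j i
      refine Finset.card_le_card fun c hc => ?_
      simp only [Finset.mem_filter, Finset.mem_range] at hc ⊢
      have h1 : T i c < T (i + 1) c := T.col_strict (Nat.lt_succ_self i) (YoungDiagram.mem_iff_lt_rowLen.2 hc.1)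
      exact ⟨hc.1.trans_le (μ.rowLen_anti i (i + 1) (Nat.le_succ i)), by omega⟩
    · intro j
      induction j with
      | zero => intro _; simp [hzero]
      | succ j ih =>
        intro hj
        have := h (j + 1)
        rw [if_pos (Finset.mem_Icc.2 ⟨by omega, hj⟩)] at this
        rw [sum_rowCount T hp, card_filter_le_succ, ← sum_rowCount T hp, ih (by omega), this]
        ring
  · intro h m
    rcases m with _ | m
    · rw [if_neg (by simp), Finset.card_eq_zero, Finset.filter_eq_empty_iff]
      rintro ⟨i, c⟩ hx h0
      rw [YoungDiagram.mem_cells, YoungDiagram.mem_iff_lt_rowLen] at hx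
      have := (T.le_iff_lt_rowCount hx 0).1 h0.le
      rw [h.zero] at this
      omega
    · split_ifs with hm
      · have hm := (Finset.mem_Icc.1 hm).2
        have := card_filter_le_succ T m
        rw [← sum_rowCount T hp, ← sum_rowCount T hp, h.sum _ hm, h.sum m (by omega)] at this
        rw [add_mul, one_mul] at this
        omega
      · rw [Finset.card_eq_zero, Finset.filter_eq_empty_iff]
        rintro ⟨i, c⟩ hx h0
        rw [YoungDiagram.mem_cells, YoungDiagram.mem_iff_lt_rowLen] at hx
        have hpm : p ≤ m := by
          rw [Finset.mem_Icc] at hm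
          omega
        have := (T.le_iff_lt_rowCount hx m).2 (by rwa [h.top m hpm])
        simp only at h0
        omega

end SemistandardYoungTableau

namespace IsGTPattern

variable {p k : ℕ} {l : ℕ → ℕ} {x : ℕ → ℕ → ℕ}

theorem monotone (h : IsGTPattern p k l x) (i : ℕ) : Monotone fun j => x j i :=
  monotone_nat_of_le_succ fun j => h.mono j i

theorem le_top (h : IsGTPattern p k l x) (j i : ℕ) : x j i ≤ l i := by
  rw [← h.top (max p j) (le_max_left _ _) i]
  exact h.monotone i (le_max_right _ _)

theorem sInf_le_iff (h : IsGTPattern p k l x) {i c : ℕ} (hc : c < l i) (j : ℕ) :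
    sInf {j | c < x j i} ≤ j ↔ c < x j i := by
  have hne : {j | c < x j i}.Nonempty := ⟨p, by simpa [h.top p le_rfl] using hc⟩
  exact ⟨fun hj => (Nat.sInf_mem hne).trans_le (h.monotone i hj), fun hj => Nat.sInf_le hj⟩

/-- The tableau in which `j` is a bound for the first `x j i` entries of row `i`. -/
noncomputable def toTableau {μ : YoungDiagram} (h : IsGTPattern p k μ.rowLen x) :
    SemistandardYoungTableau μ where
  entry i c := if c < μ.rowLen i then sInf {j | c < x j i} else 0
  row_weak' := by
    intro i c c' hlt hc'
    rw [YoungDiagram.mem_iff_lt_rowLen] at hc'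
    rw [if_pos hc', if_pos (hlt.trans hc'), h.sInf_le_iff (hlt.trans hc')]
    exact hlt.trans ((h.sInf_le_iff hc' _).1 le_rfl)
  col_strict' := by
    intro i i' c hlt hc'
    rw [YoungDiagram.mem_iff_lt_rowLen] at hc'
    rw [if_pos hc', if_pos (hc'.trans_le (μ.rowLen_anti _ _ hlt.le))]
    -- By `inter`, a cell of row `i + 1` that is filled at stage `e + 1` has the cell above it
    -- filled at stage `e`; stage 0 is empty by `zero`.
    induction i', hlt using Nat.le_induction with
    | base =>
      have h1 := (h.sInf_le_iff hc' _).1 le_rfl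
      have h2 : c < μ.rowLen i := hc'.trans_le (μ.rowLen_anti _ _ (Nat.le_succ i))
      rcases he : sInf {j | c < x j (i + 1)} with _ | e
      · rw [he, h.zero] at h1
        omega
      · rw [he] at h1
        exact Nat.lt_succ_of_le ((h.sInf_le_iff h2 e).2 (h1.trans_le (h.inter e i)))
    | succ i' hi' ih =>
      have h2 : c < μ.rowLen i' := hc'.trans_le (μ.rowLen_anti _ _ (Nat.le_succ i'))
      refine (ih h2).trans ?_
      have h1 := (h.sInf_le_iff hc' _).1 le_rfl
      rcases he : sInf {j | c < x j (i' + 1)} with _ | e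
      · rw [he, h.zero] at h1
        omega
      · rw [he] at h1
        exact Nat.lt_succ_of_le ((h.sInf_le_iff h2 e).2 (h1.trans_le (h.inter e i')))
  zeros' := by
    intro i c hc
    rw [YoungDiagram.mem_iff_lt_rowLen] at hc
    rw [if_neg hc]

theorem rowCount_toTableau {μ : YoungDiagram} (h : IsGTPattern p k μ.rowLen x) :
    h.toTableau.rowCount = x := by
  funext j i
  have : (Finset.range (μ.rowLen i)).filter (fun c => h.toTableau i c ≤ j) =
      Finset.range (x j i) := by
    ext c
    simp only [Finset.mem_filter, Finset.mem_range]
    constructor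
    · rintro ⟨hc, hle⟩
      have h1 : h.toTableau i c = sInf {j | c < x j i} := if_pos hc
      rw [h1] at hle
      exact (h.sInf_le_iff hc j).1 hle
    · intro hc
      have hc' := hc.trans_le (h.le_top j i)
      have h1 : h.toTableau i c = sInf {j | c < x j i} := if_pos hc'
      exact ⟨hc', by rw [h1]; exact (h.sInf_le_iff hc' j).2 hc⟩
  rw [SemistandardYoungTableau.rowCount, this, Finset.card_range]

end IsGTPattern

theorem SemistandardYoungTableau.rowCount_injective {μ : YoungDiagram} :
    Function.Injective (SemistandardYoungTableau.rowCount (μ := μ)) := by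
  intro S T h
  apply SemistandardYoungTableau.ext
  intro i c
  by_cases hc : c < μ.rowLen i
  · apply le_antisymm
    · rw [S.le_iff_lt_rowCount hc, h, ← T.le_iff_lt_rowCount hc]
    · rw [T.le_iff_lt_rowCount hc, ← h, ← S.le_iff_lt_rowCount hc]
  · rw [← YoungDiagram.mem_iff_lt_rowLen] at hc
    rw [S.zeros hc, T.zeros hc]

theorem tableauCount_eq_ncard {p : ℕ} (k : ℕ) {μ : YoungDiagram}
    (hp : ∀ i, p ≤ i → μ.rowLen i = 0) :
    tableauCount p k μ = {x | IsGTPattern p k μ.rowLen x}.ncard := by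
  rw [tableauCount, ← Nat.card_coe_set_eq]
  refine Nat.card_congr (Equiv.ofBijective
    (fun T => ⟨T.1.rowCount, (T.1.hasContent_iff_isGTPattern k hp).1 T.2⟩) ⟨?_, ?_⟩)
  · intro S T h
    exact Subtype.ext (SemistandardYoungTableau.rowCount_injective (congrArg Subtype.val h))
  · rintro ⟨x, hx⟩
    refine ⟨⟨IsGTPattern.toTableau hx, ?_⟩, Subtype.ext hx.rowCount_toTableau⟩
    rw [SemistandardYoungTableau.hasContent_iff_isGTPattern _ _ hp, hx.rowCount_toTableau]
    exact hx

/-! ### Patterns as lattice points of a dilated polytope. -/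

/-- The defining (in)equalities of the Gelfand–Tsetlin patterns with top row `d * l` and weights
`d * k`. -/
def gtSystem (p k : ℕ) (l : ℕ → ℕ) (d : ℕ) (x : Fin (p + 1) × Fin p → ℕ) : Prop :=
  (∀ i, x (0, i) = d * 0) ∧ (∀ i : Fin p, x (Fin.last p, i) = d * l i) ∧
  (∀ j : Fin p, ∀ i, x (j.castSucc, i) ≤ x (j.succ, i)) ∧
  (∀ j i i' : Fin p, (i' : ℕ) = i + 1 → x (j.succ, i') ≤ x (j.castSucc, i)) ∧
  ∀ j : Fin (p + 1), ∑ i, x (j, i) = d * (j * k)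

theorem isLinearSystem_gtSystem (p k : ℕ) (l : ℕ → ℕ) : IsLinearSystem (gtSystem p k l) := by
  open IsLinearSystem in
  refine (forall_fin fun i => .eq (isForm_coord _) (isForm_mul _)).and <|
    (forall_fin fun i => .eq (isForm_coord _) (isForm_mul _)).and <|
    (forall_fin fun j => forall_fin fun i => .le (isForm_coord _) (isForm_coord _)).and <|
    (forall_fin fun j => forall_fin fun i => forall_fin fun i' => of_imp _ fun _ =>
      .le (isForm_coord _) (isForm_coord _)).and <|
    forall_fin fun j => .eq (isForm_sum fun i => isForm_coord _) (isForm_mul _)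

theorem injOn_restrict_gtPattern {p : ℕ} (k : ℕ) {l : ℕ → ℕ} (hp : ∀ i, p ≤ i → l i = 0) :
    Set.InjOn (fun (X : ℕ → ℕ → ℕ) (a : Fin (p + 1) × Fin p) => X a.1 a.2)
      {x | IsGTPattern p k l x} := by
  intro X hX Y hY h
  funext j i
  by_cases hi : i < p
  · by_cases hj : j < p + 1
    · exact congrFun h (⟨j, hj⟩, ⟨i, hi⟩)
    · rw [hX.top j (by omega), hY.top j (by omega)]
  · have h1 := hX.le_top j i
    have h2 := hY.le_top j i
    rw [hp i (not_lt.1 hi)] at h1 h2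
    omega

theorem finite_gtPattern {p : ℕ} (k : ℕ) {l : ℕ → ℕ} (hp : ∀ i, p ≤ i → l i = 0) :
    {x | IsGTPattern p k l x}.Finite := by
  refine Set.Finite.of_finite_image ?_ (injOn_restrict_gtPattern k hp)
  refine (Set.finite_Iic fun a : Fin (p + 1) × Fin p => l a.2).subset ?_
  rintro _ ⟨X, hX, rfl⟩ a
  exact hX.le_top _ _

theorem gtSystem_ncard (p k : ℕ) {l : ℕ → ℕ} (hl : Antitone l) (hp : ∀ i, p ≤ i → l i = 0) (d : ℕ) :
    {x | gtSystem p k l d x}.ncard = {x | IsGTPattern p (d * k) (fun i => d * l i) x}.ncard := by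
  set r : (ℕ → ℕ → ℕ) → Fin (p + 1) × Fin p → ℕ := fun X a => X a.1 a.2 with hr
  have hinj : Set.InjOn r {x | IsGTPattern p (d * k) (fun i => d * l i) x} :=
    injOn_restrict_gtPattern _ fun i hi => by rw [hp i hi, mul_zero]
  rw [← hinj.ncard_image]
  congr 1
  ext x
  constructor
  · rintro ⟨h1, h2, h3, h4, h5⟩
    -- Freezing the row index at `p` and padding with zeros is the only extension compatible with
    -- `top` and the vanishing of `l` from `p` on.
    set X : ℕ → ℕ → ℕ := fun j i =>
      if h : i < p then x (⟨min j p, by omega⟩, ⟨i, h⟩) else 0 with hXdef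
    have hX : ∀ (j : Fin (p + 1)) (i : Fin p), X j i = x (j, i) := by
      intro j i
      have : min (j : ℕ) p = j := by omega
      simp only [hXdef, i.2, dif_pos, this]
    have hXp : ∀ j, p ≤ j → ∀ i, X j i = X p i := by
      intro j hj i
      simp only [hXdef, min_eq_right hj, min_self]
    have hX0 : ∀ j i, p ≤ i → X j i = 0 := fun j i hi => dif_neg (by omega)
    have htop : ∀ j, p ≤ j → ∀ i, X j i = d * l i := by
      intro j hj i
      rw [hXp j hj]
      by_cases hi : i < p
      · exact (hX (Fin.last p) ⟨i, hi⟩).trans (h2 ⟨i, hi⟩)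
      · rw [hX0 _ _ (not_lt.1 hi), hp i (not_lt.1 hi), mul_zero]
    refine ⟨X, ⟨?_, htop, ?_, ?_, ?_⟩, ?_⟩
    · intro i
      by_cases hi : i < p
      · exact (hX 0 ⟨i, hi⟩).trans (h1 ⟨i, hi⟩)
      · exact hX0 _ _ (not_lt.1 hi)
    · intro j i
      by_cases hj : j < p
      · by_cases hi : i < p
        · have := h3 ⟨j, hj⟩ ⟨i, hi⟩
          rwa [← hX, ← hX] at this
        · rw [hX0 _ _ (not_lt.1 hi)]
          exact Nat.zero_le _
      · rw [htop j (by omega), htop (j + 1) (by omega)]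
    · intro j i
      by_cases hi : i + 1 < p
      · by_cases hj : j < p
        · have := h4 ⟨j, hj⟩ ⟨i, by omega⟩ ⟨i + 1, hi⟩ rfl
          rwa [← hX, ← hX] at this
        · rw [htop j (by omega), htop (j + 1) (by omega)]
          exact Nat.mul_le_mul_left _ (hl (Nat.le_succ i))
      · rw [hX0 _ _ (not_lt.1 hi)]
        exact Nat.zero_le _
    · intro j hj
      have := h5 ⟨j, by omega⟩
      simp only [← hX] at this
      rw [Finset.sum_range, this]
      ring
    · funext a
      exact hX a.1 a.2
  · rintro ⟨X, hX, rfl⟩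
    refine ⟨fun i => (hX.zero _).trans (mul_zero d).symm, fun i => hX.top p le_rfl _,
      fun j i => hX.mono _ _, fun j i i' h => ?_, fun j => ?_⟩
    · simp only [hr, h]
      exact hX.inter _ _
    · have := hX.sum j (by omega)
      rw [Finset.sum_range] at this
      simp only [hr, this]
      ring

theorem isQuasiPoly_ncard_gtPattern (p k : ℕ) {l : ℕ → ℕ} (hl : Antitone l)
    (hp : ∀ i, p ≤ i → l i = 0) (hne : ∃ x, IsGTPattern p k l x) :
    IsQuasiPoly fun d =>
      ({x | IsGTPattern p (d * k) (fun i => d * l i) x}.ncard : ℚ) := by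
  simp only [← gtSystem_ncard p k hl hp]
  refine (isLinearSystem_gtSystem p k l).isQuasiPoly (fun d => ?_) ?_
  · refine (Set.finite_Iic fun a : Fin (p + 1) × Fin p => d * l a.2).subset ?_
    rintro x ⟨h1, h2, h3, h4, h5⟩ ⟨j, i⟩
    have hm : Monotone fun j => x (j, i) := Fin.monotone_iff_le_succ.2 fun j => h3 j i
    exact (hm (Fin.le_last j)).trans (h2 i).le
  · obtain ⟨X, hX⟩ := hne
    refine ⟨fun a => X a.1 a.2, fun i => (hX.zero _).trans (mul_zero 1).symm,
      fun i => (hX.top p le_rfl _).trans (one_mul _).symm,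
      fun j i => hX.mono _ _, fun j i i' h => ?_, fun j => ?_⟩
    · simp only [h]
      exact hX.inter _ _
    · have := hX.sum j (by omega)
      rw [Finset.sum_range] at this
      rw [one_mul, ← this]

/-! ### Addition, extension and uniqueness of patterns. -/

namespace IsGTPattern

variable {p k k' : ℕ} {l l' : ℕ → ℕ} {x y : ℕ → ℕ → ℕ}

theorem add (hx : IsGTPattern p k l x) (hy : IsGTPattern p k' l' y) :
    IsGTPattern p (k + k') (fun i => l i + l' i) (x + y) where
  zero i := by simp [hx.zero, hy.zero]
  top j hj i := by simp [hx.top j hj, hy.top j hj]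
  mono j i := Nat.add_le_add (hx.mono j i) (hy.mono j i)
  inter j i := Nat.add_le_add (hx.inter j i) (hy.inter j i)
  sum j hj := by
    simp only [Pi.add_apply, Finset.sum_add_distrib, hx.sum j hj, hy.sum j hj]
    ring

theorem nsmul (n : ℕ) (hx : IsGTPattern p k l x) :
    IsGTPattern p (n * k) (fun i => n * l i) (n • x) where
  zero i := by simp [hx.zero]
  top j hj i := by simp [hx.top j hj]
  mono j i := Nat.mul_le_mul_left n (hx.mono j i)
  inter j i := Nat.mul_le_mul_left n (hx.inter j i)
  sum j hj := by
    simp only [Pi.smul_apply, smul_eq_mul, ← Finset.mul_sum, hx.sum j hj]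
    ring

theorem eq_zero_of_le (h : IsGTPattern p k l x) : ∀ {j i : ℕ}, j ≤ i → x j i = 0
  | 0, i, _ => h.zero i
  | j + 1, 0, hji => by omega
  | j + 1, i + 1, hji => by
    have := h.inter j i
    rw [h.eq_zero_of_le (by omega : j ≤ i)] at this
    omega

/-- Adding a new top row. -/
theorem extend (hsum : ∑ i ∈ Finset.range (p + 1), l i = (p + 1) * k)
    (hle : ∀ i, l' i ≤ l i) (hge : ∀ i, l (i + 1) ≤ l' i) (hx : IsGTPattern p k l' x) :
    IsGTPattern (p + 1) k l fun j => if j ≤ p then x j else l where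
  zero i := by simpa using hx.zero i
  top j hj i := by rw [if_neg (by omega)]
  mono j i := by
    by_cases h1 : j + 1 ≤ p
    · rw [if_pos h1, if_pos (by omega)]
      exact hx.mono j i
    · rw [if_neg h1]
      split_ifs with h2
      · exact (hx.le_top j i).trans (hle i)
      · exact le_rfl
  inter j i := by
    by_cases h1 : j + 1 ≤ p
    · rw [if_pos h1, if_pos (by omega)]
      exact hx.inter j i
    · rw [if_neg h1]
      split_ifs with h2
      · rw [hx.top j (by omega)]
        exact hge i
      · exact (hge i).trans (hle i)
  sum j hj := by
    by_cases h1 : j ≤ p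
    · simp only [if_pos h1]
      rw [Finset.sum_range_succ, hx.sum j h1, hx.eq_zero_of_le h1, add_zero]
    · simp only [if_neg h1]
      rw [hsum, show j = p + 1 by omega]

/-- The prescribed row sum recovers one missing entry. -/
theorem eq_row_of_eq_off (hx : IsGTPattern p k l x) (hy : IsGTPattern p k l y) {j m : ℕ}
    (hj : j ≤ p) (hm : m < p) (h : ∀ i, i ≠ m → x j i = y j i) : x j = y j := by
  funext i
  by_cases hi : i = m
  · have h1 := (hx.sum j hj).trans (hy.sum j hj).symm
    have h2 := Finset.add_sum_erase _ (fun i => x j i) (Finset.mem_range.2 hm)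
    have h3 := Finset.add_sum_erase _ (fun i => y j i) (Finset.mem_range.2 hm)
    have h4 : ∑ i ∈ (Finset.range p).erase m, x j i = ∑ i ∈ (Finset.range p).erase m, y j i :=
      Finset.sum_congr rfl fun i hi => h i (Finset.ne_of_mem_erase hi)
    rw [hi]
    omega
  · exact h i hi

theorem eq_of_rows (hx : IsGTPattern p k l x) (hy : IsGTPattern p k l y)
    (h : ∀ t ≤ p, x (p - t) = y (p - t)) : x = y := by
  funext j
  by_cases hj : j ≤ p
  · have := h (p - j) (by omega)
    rwa [show p - (p - j) = j by omega] at this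
  · funext i
    rw [hx.top j (by omega), hy.top j (by omega)]

/-- Going down from the top, interlacing squeezes all entries of each row but the first between two
copies of `c`; the row sum then fixes the first. -/
theorem unique_of_tail (hx : IsGTPattern p k l x) (hy : IsGTPattern p k l y) {c : ℕ}
    (hc : ∀ i, 1 ≤ i → i < p → l i = c) : x = y := by
  have key : ∀ t ≤ p, x (p - t) = y (p - t) ∧
      ∀ i, 1 ≤ i → i < p - t → x (p - t) i = c := by
    intro t
    induction t with
    | zero =>
      intro _
      refine ⟨funext fun i => (hx.top p le_rfl i).trans (hy.top p le_rfl i).symm, fun i h1 h2 => ?_⟩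
      exact (hx.top p le_rfl i).trans (hc i h1 h2)
    | succ t ih =>
      intro ht
      obtain ⟨h1, h2⟩ := ih (by omega)
      obtain ⟨j, hj⟩ : ∃ j, p - t = j + 1 := ⟨p - (t + 1), by omega⟩
      rw [hj] at h1 h2
      rw [show p - (t + 1) = j by omega]
      have hrow : ∀ z, IsGTPattern p k l z → z (j + 1) = x (j + 1) →
          ∀ i, 1 ≤ i → i < j → z j i = c := by
        intro z hz hzx i hi hij
        have a1 := hz.mono j i
        have a2 := hz.inter j i
        rw [hzx, h2 i hi (by omega)] at a1
        rw [hzx, h2 (i + 1) (by omega) (by omega)] at a2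
        omega
      refine ⟨eq_row_of_eq_off hx hy (by omega) (show 0 < p by omega) fun i hi => ?_,
        hrow x hx rfl⟩
      by_cases hij : i < j
      · rw [hrow x hx rfl i (by omega) hij, hrow y hy h1.symm i (by omega) hij]
      · rw [hx.eq_zero_of_le (not_lt.1 hij), hy.eq_zero_of_le (not_lt.1 hij)]
  exact eq_of_rows hx hy fun t ht => (key t ht).1

/-- The mirror image of `unique_of_tail`: in row `j` only the entry of index `j - 1` is not
squeezed. -/
theorem unique_of_init (hx : IsGTPattern p k l x) (hy : IsGTPattern p k l y) {c : ℕ}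
    (hc : ∀ i, i + 1 < p → l i = c) : x = y := by
  have key : ∀ t ≤ p, x (p - t) = y (p - t) ∧
      ∀ i, i + 1 < p - t → x (p - t) i = c := by
    intro t
    induction t with
    | zero =>
      intro _
      refine ⟨funext fun i => (hx.top p le_rfl i).trans (hy.top p le_rfl i).symm, fun i h2 => ?_⟩
      exact (hx.top p le_rfl i).trans (hc i h2)
    | succ t ih =>
      intro ht
      obtain ⟨h1, h2⟩ := ih (by omega)
      obtain ⟨j, hj⟩ : ∃ j, p - t = j + 1 := ⟨p - (t + 1), by omega⟩
      rw [hj] at h1 h2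
      rw [show p - (t + 1) = j by omega]
      have hrow : ∀ z, IsGTPattern p k l z → z (j + 1) = x (j + 1) →
          ∀ i, i + 1 < j → z j i = c := by
        intro z hz hzx i hij
        have a1 := hz.mono j i
        have a2 := hz.inter j i
        rw [hzx, h2 i (by omega)] at a1
        rw [hzx, h2 (i + 1) (by omega)] at a2
        omega
      -- For `j = 0` the index `j - 1` truncates to 0, which is harmless because that row is zero.
      refine ⟨eq_row_of_eq_off hx hy (by omega) (show j - 1 < p by omega) fun i hi => ?_,
        hrow x hx rfl⟩
      by_cases hij : i + 1 < j
      · rw [hrow x hx rfl i hij, hrow y hy h1.symm i hij]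
      · rw [hx.eq_zero_of_le (by omega), hy.eq_zero_of_le (by omega)]
  exact eq_of_rows hx hy fun t ht => (key t ht).1

end IsGTPattern

/-! ### Choosing interlacing rows with a given sum. -/

theorem exists_sum_range_eq_of_le {lo hi : ℕ → ℕ} (h : ∀ i, lo i ≤ hi i) (n : ℕ) : ∀ N : ℕ,
    ∑ i ∈ Finset.range n, lo i ≤ N → N ≤ ∑ i ∈ Finset.range n, hi i →
    ∃ f : ℕ → ℕ, (∀ i, lo i ≤ f i) ∧ (∀ i, f i ≤ hi i) ∧ ∑ i ∈ Finset.range n, f i = N := by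
  induction n with
  | zero =>
    intro N _ h2
    exact ⟨lo, fun _ => le_rfl, h, by simpa using (Nat.le_zero.1 h2).symm⟩
  | succ n ih =>
    intro N h1 h2
    rw [Finset.sum_range_succ] at h1 h2
    have h3 := h n
    have h4 : ∑ i ∈ Finset.range n, lo i ≤ ∑ i ∈ Finset.range n, hi i :=
      Finset.sum_le_sum fun i _ => h i
    -- The least admissible sum of the first `n` entries; what is left for entry `n` then lies
    -- between `lo n` and `hi n`.
    obtain ⟨f, f1, f2, f3⟩ := ih (max (∑ i ∈ Finset.range n, lo i) (N - hi n)) (le_max_left _ _)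
      (by omega)
    refine ⟨Function.update f n (N - ∑ i ∈ Finset.range n, f i), fun i => ?_, fun i => ?_, ?_⟩
    · by_cases hin : i = n
      · subst hin; simp only [Function.update_self]; omega
      · simpa [hin] using f1 i
    · by_cases hin : i = n
      · subst hin; simp only [Function.update_self]; omega
      · simpa [hin] using f2 i
    · rw [Finset.sum_range_succ, Function.update_self, Finset.sum_congr rfl fun i hi =>
        Function.update_of_ne (Finset.mem_range.1 hi).ne _ _]
      omega

/-- A unit is moved from an entry above its lower bound to a different entry below its upper bound.
The strict sum inequalities give one entry of each kind; should they coincide, a second non-rigid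
coordinate serves as one of the two. -/
theorem exists_ne_sum_range_eq {lo hi f : ℕ → ℕ} {n : ℕ} (f1 : ∀ i, lo i ≤ f i)
    (f2 : ∀ i, f i ≤ hi i) (hlo : ∑ i ∈ Finset.range n, lo i < ∑ i ∈ Finset.range n, f i)
    (hhi : ∑ i ∈ Finset.range n, f i < ∑ i ∈ Finset.range n, hi i) {i₁ i₂ : ℕ} (hne : i₁ ≠ i₂)
    (h1 : i₁ < n) (h2 : i₂ < n) (h1' : lo i₁ < hi i₁) (h2' : lo i₂ < hi i₂) :
    ∃ g : ℕ → ℕ, g ≠ f ∧ (∀ i, lo i ≤ g i) ∧ (∀ i, g i ≤ hi i) ∧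
      ∑ i ∈ Finset.range n, g i = ∑ i ∈ Finset.range n, f i := by
  obtain ⟨a, ha, b, hb, hab, ha', hb'⟩ : ∃ a < n, ∃ b < n, a ≠ b ∧ lo a < f a ∧ f b < hi b := by
    by_contra! hcon
    obtain ⟨a, ha, ha'⟩ := Finset.exists_lt_of_sum_lt hlo
    obtain ⟨b, hb, hb'⟩ := Finset.exists_lt_of_sum_lt hhi
    rw [Finset.mem_range] at ha hb
    have hab : a = b := by
      by_contra hab
      exact absurd (hcon a ha b hb hab ha') (not_le.2 hb')
    subst hab
    obtain ⟨c, hc, hca, hc'⟩ : ∃ c < n, c ≠ a ∧ lo c < hi c := by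
      by_cases h : i₁ = a
      · exact ⟨i₂, h2, fun h' => hne (h.trans h'.symm), h2'⟩
      · exact ⟨i₁, h1, h, h1'⟩
    have h3 := hcon a ha c hc hca.symm ha'
    exact absurd (hcon c hc a ha hca (hc'.trans_le h3)) (not_le.2 hb')
  refine ⟨fun i => if i = a then f a - 1 else if i = b then f b + 1 else f i, fun h => ?_,
    fun i => ?_, fun i => ?_, ?_⟩
  · have := congrFun h a
    simp only [if_true] at this
    omega
  · dsimp only
    split_ifs with h h'
    · subst h; omega
    · subst h'; have := f1 i; omega
    · exact f1 i
  · dsimp only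
    split_ifs with h h'
    · subst h; have := f2 i; omega
    · subst h'; omega
    · exact f2 i
  · have hbm : b ∈ (Finset.range n).erase a := Finset.mem_erase.2 ⟨hab.symm, Finset.mem_range.2 hb⟩
    rw [← Finset.add_sum_erase _ _ (Finset.mem_range.2 ha), ← Finset.add_sum_erase _ _ hbm,
      Finset.sum_congr (s₂ := ((Finset.range n).erase a).erase b) (g := fun i => f i) rfl
        fun i hi => ?_]
    · have e1 := Finset.add_sum_erase _ (fun i => f i) (Finset.mem_range.2 ha)
      have e2 := Finset.add_sum_erase _ (fun i => f i) hbm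
      simp only [if_true, if_neg hab.symm] at e1 e2 ⊢
      omega
    · rw [if_neg (Finset.ne_of_mem_erase (Finset.mem_of_mem_erase hi)),
        if_neg (Finset.ne_of_mem_erase hi)]

section Existence

variable {p k : ℕ} {l : ℕ → ℕ}

theorem Antitone.le_zero_of_sum_range (hl : Antitone l)
    (hsum : ∑ i ∈ Finset.range (p + 1), l i = (p + 1) * k) : k ≤ l 0 := by
  by_contra h
  have : ∑ i ∈ Finset.range (p + 1), l i < ∑ i ∈ Finset.range (p + 1), k :=
    Finset.sum_lt_sum_of_nonempty (by simp) fun i _ => (hl (Nat.zero_le i)).trans_lt (not_le.1 h)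
  simp [hsum] at this

theorem Antitone.last_le_of_sum_range (hl : Antitone l)
    (hsum : ∑ i ∈ Finset.range (p + 1), l i = (p + 1) * k) : l p ≤ k := by
  by_contra h
  have : ∑ i ∈ Finset.range (p + 1), k < ∑ i ∈ Finset.range (p + 1), l i :=
    Finset.sum_lt_sum_of_nonempty (by simp) fun i hi =>
      (not_le.1 h).trans_le (hl (Nat.le_of_lt_succ (Finset.mem_range.1 hi)))
  simp [hsum] at this

theorem Antitone.lt_zero_of_sum_range (hl : Antitone l)
    (hsum : ∑ i ∈ Finset.range (p + 1), l i = (p + 1) * k) (hlt : l p < l 0) : k < l 0 := by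
  by_contra h
  have : ∑ i ∈ Finset.range (p + 1), l i < ∑ i ∈ Finset.range (p + 1), k :=
    Finset.sum_lt_sum (fun i _ => (hl (Nat.zero_le i)).trans (not_lt.1 h))
      ⟨p, by simp, hlt.trans_le (not_lt.1 h)⟩
  simp [hsum] at this

theorem Antitone.last_lt_of_sum_range (hl : Antitone l)
    (hsum : ∑ i ∈ Finset.range (p + 1), l i = (p + 1) * k) (hlt : l p < l 0) : l p < k := by
  by_contra h
  have : ∑ i ∈ Finset.range (p + 1), k < ∑ i ∈ Finset.range (p + 1), l i :=
    Finset.sum_lt_sum (fun i hi => (not_lt.1 h).trans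
      (hl (Nat.le_of_lt_succ (Finset.mem_range.1 hi)))) ⟨0, by simp, (not_lt.1 h).trans_lt hlt⟩
  simp [hsum] at this

theorem le_truncate_of_antitone (hl : Antitone l) (hp : ∀ i, p + 1 ≤ i → l i = 0) (i : ℕ) :
    l (i + 1) ≤ if i < p then l i else 0 := by
  split_ifs with h
  · exact hl (Nat.le_succ i)
  · rw [hp (i + 1) (by omega)]

theorem sum_range_truncate : ∑ i ∈ Finset.range p, (if i < p then l i else 0) =
    ∑ i ∈ Finset.range p, l i :=
  Finset.sum_congr rfl fun _ hi => if_pos (Finset.mem_range.1 hi)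

/-- There is a row interlacing with `l` whose entries have the same mean `k`. -/
theorem exists_interlacing (hl : Antitone l) (hp : ∀ i, p + 1 ≤ i → l i = 0)
    (hsum : ∑ i ∈ Finset.range (p + 1), l i = (p + 1) * k) :
    ∃ l' : ℕ → ℕ, (∀ i, l (i + 1) ≤ l' i) ∧ (∀ i, l' i ≤ if i < p then l i else 0) ∧
      ∑ i ∈ Finset.range p, l' i = p * k := by
  refine exists_sum_range_eq_of_le (lo := fun i => l (i + 1)) (le_truncate_of_antitone hl hp) p
    (p * k) ?_ ?_
  -- The first part is at least the mean `k` and the last at most `k`, so `p * k` lies between the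
  -- sums obtained by omitting the first and the last part.
  · have h1 := hl.le_zero_of_sum_range hsum
    rw [Finset.sum_range_succ', add_mul, one_mul] at hsum
    omega
  · have h1 := hl.last_le_of_sum_range hsum
    rw [Finset.sum_range_succ, add_mul, one_mul] at hsum
    rw [sum_range_truncate]
    omega

/-- Any interlacing row of mean `k` is again an admissible top row with one part fewer, so a pattern
is built downwards. -/
theorem exists_isGTPattern (hl : Antitone l) (hp : ∀ i, p ≤ i → l i = 0)
    (hsum : ∑ i ∈ Finset.range p, l i = p * k) : ∃ x, IsGTPattern p k l x := by
  induction p generalizing l with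
  | zero => exact ⟨fun _ _ => 0, fun _ => rfl, fun _ _ i => (hp i (Nat.zero_le i)).symm,
      fun _ _ => le_rfl, fun _ _ => le_rfl, fun j hj => by simp [Nat.le_zero.1 hj]⟩
  | succ p ih =>
    obtain ⟨l', h1, h2, h3⟩ := exists_interlacing hl hp hsum
    have h2' : ∀ i, l' i ≤ l i := fun i => (h2 i).trans (by split_ifs <;> simp)
    obtain ⟨x, hx⟩ := ih (antitone_nat_of_succ_le fun i => (h2' (i + 1)).trans (h1 i))
      (fun i hi => Nat.le_zero.1 ((h2 i).trans (by rw [if_neg (not_lt.2 hi)]))) h3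
    exact ⟨_, hx.extend hsum h2' h1⟩

/-- Each drop of `l` is a coordinate of the next row with room to move, so two drops allow two
different rows with the required sum, and each completes to a pattern. -/
theorem exists_ne_isGTPattern_of_two_drops (hl : Antitone l) (hp : ∀ i, p + 1 ≤ i → l i = 0)
    (hsum : ∑ i ∈ Finset.range (p + 1), l i = (p + 1) * k) {i₁ i₂ : ℕ} (hne : i₁ ≠ i₂)
    (h1 : i₁ < p) (h2 : i₂ < p) (h1' : l (i₁ + 1) < l i₁) (h2' : l (i₂ + 1) < l i₂) :
    ∃ x y, x ≠ y ∧ IsGTPattern (p + 1) k l x ∧ IsGTPattern (p + 1) k l y := by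
  obtain ⟨f, f1, f2, f3⟩ := exists_interlacing hl hp hsum
  have hlt : l p < l 0 := (hl (by omega : i₁ + 1 ≤ p)).trans_lt (h1'.trans_le (hl (Nat.zero_le _)))
  obtain ⟨g, hgf, g1, g2, g3⟩ := exists_ne_sum_range_eq (n := p) f1 f2
    (by
      have := hl.lt_zero_of_sum_range hsum hlt
      rw [Finset.sum_range_succ', add_mul, one_mul] at hsum
      omega)
    (by
      have := hl.last_lt_of_sum_range hsum hlt
      rw [Finset.sum_range_succ, add_mul, one_mul] at hsum
      rw [sum_range_truncate]
      omega) hne h1 h2 (by rwa [if_pos h1]) (by rwa [if_pos h2])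
  have key : ∀ l' : ℕ → ℕ, (∀ i, l (i + 1) ≤ l' i) → (∀ i, l' i ≤ if i < p then l i else 0) →
      ∑ i ∈ Finset.range p, l' i = p * k → ∃ x, IsGTPattern (p + 1) k l x ∧ x p = l' := by
    intro l' h1 h2 h3
    have h2' : ∀ i, l' i ≤ l i := fun i => (h2 i).trans (by split_ifs <;> simp)
    obtain ⟨x, hx⟩ := exists_isGTPattern
      (antitone_nat_of_succ_le fun i => (h2' (i + 1)).trans (h1 i))
      (fun i hi => Nat.le_zero.1 ((h2 i).trans (by rw [if_neg (not_lt.2 hi)]))) h3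
    exact ⟨_, hx.extend hsum h2' h1, by simpa using funext (hx.top p le_rfl)⟩
  obtain ⟨x, hx, hxf⟩ := key f f1 f2 f3
  obtain ⟨y, hy, hyg⟩ := key g g1 g2 (g3.trans f3)
  exact ⟨x, y, fun h => hgf (by rw [← hyg, ← hxf, h]), hx, hy⟩

/-- Row `p` can vary only at `s`, and the mean condition keeps its entry there strictly between the
two values of `l`. It thus drops at both `s - 1` and `s`, and the two-drop case applies one level
down. -/
theorem exists_ne_isGTPattern_of_inner_drop (hl : Antitone l) (hp : ∀ i, p + 1 ≤ i → l i = 0)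
    (hsum : ∑ i ∈ Finset.range (p + 1), l i = (p + 1) * k) {s : ℕ} (hs : 1 ≤ s) (hsp : s + 1 < p)
    (hlt : l (s + 1) < l s) (hle : ∀ i ≤ s, l i = l s)
    (hgt : ∀ i, s < i → i ≤ p → l i = l (s + 1)) :
    ∃ x y, x ≠ y ∧ IsGTPattern (p + 1) k l x ∧ IsGTPattern (p + 1) k l y := by
  obtain ⟨f, f1, f2, f3⟩ := exists_interlacing hl hp hsum
  have f2' : ∀ i, f i ≤ l i := fun i => (f2 i).trans (by split_ifs <;> simp)
  have hltp : l p < l 0 := by rwa [hle 0 (Nat.zero_le s), hgt p (by omega) le_rfl]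
  have hsum' := hsum
  -- Equality would make row `p` consist of the first `p` parts of `l`, whose sum exceeds `p * k`
  -- because the omitted last part is below the mean.
  have hs1 : f s < l s := by
    refine lt_of_le_of_ne (f2' s) fun heq => ?_
    have h1 := hl.last_lt_of_sum_range hsum hltp
    have h2 : ∑ i ∈ Finset.range p, f i = ∑ i ∈ Finset.range p, l i := by
      refine Finset.sum_congr rfl fun i hi => le_antisymm (f2' i) ?_
      rw [Finset.mem_range] at hi
      rcases lt_trichotomy i s with h | rfl | h
      · rw [hle i h.le, ← hle (i + 1) h]
        exact f1 i
      · exact heq.ge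
      · rw [hgt i h hi.le, ← hgt (i + 1) (by omega) hi]
        exact f1 i
    rw [Finset.sum_range_succ, add_mul, one_mul] at hsum'
    omega
  have hs2 : l (s + 1) < f s := by
    refine lt_of_le_of_ne (f1 s) fun heq => ?_
    have h1 := hl.lt_zero_of_sum_range hsum hltp
    have h2 : ∑ i ∈ Finset.range p, f i = ∑ i ∈ Finset.range p, l (i + 1) := by
      refine Finset.sum_congr rfl fun i hi => le_antisymm ?_ (f1 i)
      rw [Finset.mem_range] at hi
      rcases lt_trichotomy i s with h | rfl | h
      · rw [hle (i + 1) h, ← hle i h.le]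
        exact f2' i
      · exact heq.ge
      · rw [hgt (i + 1) (by omega) hi, ← hgt i h hi.le]
        exact f2' i
    rw [Finset.sum_range_succ', add_mul, one_mul] at hsum'
    omega
  obtain ⟨q, rfl⟩ : ∃ q, p = q + 1 := ⟨p - 1, by omega⟩
  obtain ⟨t, rfl⟩ : ∃ t, s = t + 1 := ⟨s - 1, by omega⟩
  obtain ⟨x, y, hxy, hx, hy⟩ := exists_ne_isGTPattern_of_two_drops (p := q) (k := k)
    (antitone_nat_of_succ_le fun i => (f2' (i + 1)).trans (f1 i))
    (fun i hi => Nat.le_zero.1 ((f2 i).trans (by rw [if_neg (not_lt.2 hi)]))) f3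
    (Nat.ne_of_lt (Nat.lt_succ_self t)) (by omega) (by omega) (hs1.trans_le (f1 t))
    ((f2' _).trans_lt hs2)
  refine ⟨_, _, fun h => hxy ?_, hx.extend hsum f2' f1, hy.extend hsum f2' f1⟩
  funext j
  by_cases hj : j ≤ q + 1
  · simpa [hj] using congrFun h j
  · funext i
    rw [hx.top j (by omega), hy.top j (by omega)]

end Existence

/-! ### Monotonicity and linear growth. -/

section Counting

variable {p k : ℕ} {l : ℕ → ℕ}

theorem monotone_ncard_gtPattern (hp : ∀ i, p ≤ i → l i = 0) (hne : ∃ x, IsGTPattern p k l x) :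
    Monotone fun d : ℕ => {x | IsGTPattern p (d * k) (fun i => d * l i) x}.ncard := by
  obtain ⟨y, hy⟩ := hne
  refine monotone_nat_of_le_succ fun d => ?_
  rw [← Set.ncard_image_of_injective _ (add_left_injective y)]
  refine Set.ncard_le_ncard ?_ (finite_gtPattern _ fun i hi => by rw [hp i hi, mul_zero])
  rintro _ ⟨x, hx, rfl⟩
  have := hx.add hy
  simpa only [Set.mem_ofPred_eq, add_mul, one_mul] using this

theorem lt_ncard_gtPattern (hp : ∀ i, p ≤ i → l i = 0) {x y : ℕ → ℕ → ℕ} (hxy : x ≠ y)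
    (hx : IsGTPattern p k l x) (hy : IsGTPattern p k l y) (d : ℕ) :
    d < {x | IsGTPattern p (d * k) (fun i => d * l i) x}.ncard := by
  have hsub : (fun n => n • x + (d - n) • y) '' (Finset.range (d + 1) : Set ℕ) ⊆
      {x | IsGTPattern p (d * k) (fun i => d * l i) x} := by
    rintro _ ⟨n, hn, rfl⟩
    have hn : n ≤ d := Nat.le_of_lt_succ (by simpa using hn)
    have := (hx.nsmul n).add (hy.nsmul (d - n))
    simpa only [Set.mem_ofPred_eq, ← add_mul, Nat.add_sub_cancel' hn] using this
  have hinj : Set.InjOn (fun n => n • x + (d - n) • y) (Finset.range (d + 1) : Set ℕ) := by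
    intro n hn n' hn' h
    have hn : n ≤ d := Nat.le_of_lt_succ (by simpa using hn)
    have hn' : n' ≤ d := Nat.le_of_lt_succ (by simpa using hn')
    by_contra hnn
    refine hxy (funext fun j => funext fun i => ?_)
    have h1 := congrFun (congrFun h j) i
    simp only [Pi.add_apply, Pi.smul_apply, smul_eq_mul] at h1
    zify [hn, hn'] at h1 ⊢
    have h2 : ((n : ℤ) - n') * (x j i - y j i) = 0 := by linarith
    rcases mul_eq_zero.1 h2 with h3 | h3
    · exact absurd (by omega) hnn
    · omega
  have := Set.ncard_le_ncard hsub (finite_gtPattern _ fun i hi => by rw [hp i hi, mul_zero])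
  rw [hinj.ncard_image, Set.ncard_coe_finset, Finset.card_range] at this
  exact this

end Counting

/-! ### The leading term of a monotone quasi-polynomial. -/

-- The squeeze gives `D / X ^ n → 0` along the integers, whereas degree at least `n` would give a
-- non-zero or infinite limit in absolute value.
open Polynomial Filter in
theorem Polynomial.degree_lt_of_eval_natCast_le {D E : ℚ[X]} (h0 : ∀ s : ℕ, 0 ≤ D.eval (s : ℚ))
    (h1 : ∀ s : ℕ, D.eval (s : ℚ) ≤ E.eval (s : ℚ)) {n : ℕ} (hE : E.degree < n) :
    D.degree < n := by
  have hX : (X ^ n : ℚ[X]).degree = n := degree_X_pow n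
  have hcast : Tendsto (fun s : ℕ => (s : ℚ)) atTop atTop := tendsto_natCast_atTop_atTop
  have hlim : Tendsto (fun s : ℕ => D.eval (s : ℚ) / (X ^ n : ℚ[X]).eval (s : ℚ)) atTop
      (nhds 0) := by
    refine tendsto_of_tendsto_of_tendsto_of_le_of_le tendsto_const_nhds
      ((div_tendsto_atTop_zero_of_degree_lt E (X ^ n) (by rwa [hX])).comp hcast)
      (fun s => ?_) (fun s => ?_)
    · have := h0 s
      simp only [eval_pow, eval_X]
      positivity
    · have := h1 s
      simp only [eval_pow, eval_X, Function.comp_apply]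
      gcongr
  by_contra hD
  rcases (not_lt.1 hD).eq_or_lt with hD | hD
  · have h2 := (div_tendsto_atTop_leadingCoeff_div_of_degree_eq D (X ^ n)
      (by rw [hX, ← hD])).comp hcast
    have h3 := tendsto_nhds_unique hlim h2
    have hD0 : D ≠ 0 := by
      rintro rfl
      simp at hD
    simp only [leadingCoeff_X_pow, div_one] at h3
    exact hD0 (leadingCoeff_eq_zero.1 h3.symm)
  · have h2 := (abs_div_tendsto_atTop_atTop_of_degree_gt D (X ^ n) (by rwa [hX])
      (pow_ne_zero _ X_ne_zero)).comp hcast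
    exact not_tendsto_nhds_of_tendsto_atTop h2 _ hlim.abs

open Polynomial in
/-- A non-decreasing unbounded quasi-polynomial has positive degree and constant leading term. -/
theorem IsQuasiPoly.exists_isQuasiPolynomial {f : ℕ → ℕ} (hq : IsQuasiPoly fun d => (f d : ℚ))
    (hmono : Monotone f) (hub : ∀ d, d < f d) :
    ∃ (n : ℕ) (coef : ℕ → ℕ → ℚ), 0 < n ∧ IsQuasiPolynomial f n coef ∧
      ∃ a : ℚ, ∀ d : ℕ, coef n d = a := by
  obtain ⟨m, hm, h⟩ := hq
  choose P hP using h
  replace hP : ∀ r s : ℕ, (f (m * s + r) : ℚ) = (P r).eval (s : ℚ) := hP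
  have hm' : (m : ℚ) ≠ 0 := by positivity
  set n := (P 0).natDegree with hn
  have hn0 : 0 < n := by
    by_contra h0
    obtain ⟨c, hc⟩ : ∃ c, P 0 = C c := ⟨_, eq_C_of_natDegree_eq_zero (by omega)⟩
    have h1 := hP 0 (f 0)
    have h2 := hP 0 0
    rw [hc, eval_C] at h1 h2
    rw [← h2] at h1
    have h1 : f (m * f 0 + 0) = f (m * 0 + 0) := by exact_mod_cast h1
    have h3 := hub (m * f 0 + 0)
    rw [h1] at h3
    simp only [mul_zero, add_zero] at h3
    nlinarith
  have hdeg0 : (P 0).degree = n := degree_eq_natDegree fun h => by simp [hn, h] at hn0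
  -- Monotonicity gives `f (m * s) ≤ f (m * s + r) ≤ f (m * (s + 1))`, so `P r - P 0` lies between 0
  -- and the first difference of `P 0`, whose degree is below `n`.
  have hdiff : ∀ r ≤ m, (P r - P 0).degree < n := by
    intro r hr
    refine degree_lt_of_eval_natCast_le (E := taylor 1 (P 0) - P 0) (fun s => ?_) (fun s => ?_) ?_
    · rw [eval_sub, ← hP, ← hP, sub_nonneg]
      exact_mod_cast hmono (by omega)
    · rw [eval_sub, eval_sub, sub_le_sub_iff_right, taylor_eval, ← hP,
        show (s : ℚ) + 1 = (s + 1 : ℕ) by push_cast; ring, ← hP]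
      refine Nat.cast_le.2 (hmono ?_)
      rw [mul_add]
      omega
    · have := degree_sub_lt_left (degree_taylor (P 0) 1) (by
        rw [Ne, taylor_eq_zero]
        rintro h
        simp [hn, h] at hn0) (leadingCoeff_taylor 1 (P 0))
      rwa [degree_taylor, hdeg0] at this
  have hcoeff : ∀ r ≤ m, (P r).coeff n = (P 0).leadingCoeff := by
    intro r hr
    have := coeff_eq_zero_of_degree_lt (hdiff r hr)
    rwa [coeff_sub, sub_eq_zero] at this
  have hlc : (P 0).leadingCoeff ≠ 0 := leadingCoeff_ne_zero.2 fun h => by simp [hn, h] at hn0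
  have hdeg : ∀ r ≤ m, (P r).natDegree = n := by
    intro r hr
    refine natDegree_eq_of_le_of_coeff_ne_zero ?_ (by rwa [hcoeff r hr])
    have h1 : P r = (P r - P 0) + P 0 := by ring
    rw [h1]
    exact natDegree_add_le_of_degree_le (natDegree_le_of_degree_le (hdiff r hr).le) le_rfl
  -- The substitution `s = (d - r) / m` expresses each residue class in the variable `d`.
  set q : ℕ → ℚ[X] := fun r => C (1 / (m : ℚ)) * X + C (-(r : ℚ) / m) with hq
  have hqdeg : ∀ r, (q r).natDegree = 1 := fun r => natDegree_linear (by positivity)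
  have hqlc : ∀ r, (q r).leadingCoeff = 1 / (m : ℚ) := fun r => leadingCoeff_linear (by positivity)
  set R : ℕ → ℚ[X] := fun r => (P r).comp (q r) with hR
  have hRn : ∀ r ≤ m, (R r).coeff n = (P 0).leadingCoeff * (1 / (m : ℚ)) ^ n := by
    intro r hr
    have := coeff_comp_degree_mul_degree (p := P r) (q := q r) (by rw [hqdeg]; exact one_ne_zero)
    rw [hqdeg, mul_one, hqlc, leadingCoeff, hdeg r hr, hcoeff r hr] at this
    exact this
  have hmod : ∀ d, d % m ≤ m := fun d => (Nat.mod_lt d hm).le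
  refine ⟨n, fun i d => (R (d % m)).coeff i, hn0, ⟨fun d => ?_, ⟨m, hm, fun i _ d => ?_⟩, ⟨0, ?_⟩⟩,
    (P 0).leadingCoeff * (1 / (m : ℚ)) ^ n, fun d => hRn _ (hmod d)⟩
  · have h1 : (R (d % m)).natDegree < n + 1 := by
      refine Nat.lt_succ_of_le (natDegree_comp_le.trans ?_)
      rw [hqdeg, mul_one, hdeg _ (hmod d)]
    rw [← eval_eq_sum_range' h1, hR, eval_comp]
    have h2 : (q (d % m)).eval (d : ℚ) = (d / m : ℕ) := by
      have h3 : (d : ℚ) = m * (d / m : ℕ) + (d % m : ℕ) := by exact_mod_cast (Nat.div_add_mod d m).symm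
      simp only [hq, eval_add, eval_mul, eval_C, eval_X]
      field_simp
      linarith
    rw [h2, ← hP, Nat.div_add_mod]
  · simp only [Nat.add_mod_right]
  · simp only [hRn _ (hmod 0)]
    positivity

/-! ### Exceptional and non-exceptional shapes. -/

theorem YoungDiagram.IsExceptional.exists_const {p k : ℕ} {μ : YoungDiagram}
    (h : μ.IsExceptional p k) :
    (∃ c, ∀ i, 1 ≤ i → i < p → μ.rowLen i = c) ∨ ∃ c, ∀ i, i + 1 < p → μ.rowLen i = c := by
  rcases h with h | h | ⟨a, h⟩ | ⟨b, c, -, h⟩ | ⟨b, c, -, h⟩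
  · refine Or.inl ⟨0, fun i h1 h2 => ?_⟩
    rw [h i, List.getD_eq_default]
    simpa using h1
  · refine Or.inl ⟨k, fun i h1 h2 => ?_⟩
    rw [h i, List.getD_replicate _ h2]
  · refine Or.inr ⟨a, fun i hi => ?_⟩
    rw [h i, List.getD_replicate _ (by omega)]
  · refine Or.inl ⟨c, fun i h1 h2 => ?_⟩
    obtain ⟨i, rfl⟩ : ∃ t, i = t + 1 := ⟨i - 1, by omega⟩
    rw [h (i + 1), List.getD_cons_succ, List.getD_replicate _ (by omega)]
  · refine Or.inr ⟨b, fun i hi => ?_⟩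
    rw [h i, List.getD_append _ _ _ _ (by simp; omega), List.getD_replicate _ (by omega)]

/-- The cases are the positions of the drops among the `p + 1` parts. No drop, or a single drop at
either end, is exceptional; two drops and a single interior drop were treated above. -/
theorem YoungDiagram.exists_ne_isGTPattern {p k : ℕ} {μ : YoungDiagram}
    (hp : ∀ i, p + 1 ≤ i → μ.rowLen i = 0)
    (hsum : ∑ i ∈ Finset.range (p + 1), μ.rowLen i = (p + 1) * k)
    (hex : ¬ μ.IsExceptional (p + 1) k) :
    ∃ x y, x ≠ y ∧ IsGTPattern (p + 1) k μ.rowLen x ∧ IsGTPattern (p + 1) k μ.rowLen y := by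
  have hl : Antitone μ.rowLen := fun i j h => μ.rowLen_anti i j h
  have hconst : ∀ a b, a ≤ b → (∀ i, a ≤ i → i < b → ¬ μ.rowLen (i + 1) < μ.rowLen i) →
      ∀ i, a ≤ i → i ≤ b → μ.rowLen i = μ.rowLen a := by
    intro a b hab h i hai
    induction i, hai using Nat.le_induction with
    | base => intro _; rfl
    | succ i hai ih =>
      intro hib
      rw [← ih (by omega)]
      exact le_antisymm (hl (Nat.le_succ i)) (not_lt.1 (h i hai (by omega)))
  by_cases hdrop : ∃ s < p, μ.rowLen (s + 1) < μ.rowLen s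
  · obtain ⟨s, hsp, hs⟩ := hdrop
    by_cases htwo : ∃ t < p, t ≠ s ∧ μ.rowLen (t + 1) < μ.rowLen t
    · obtain ⟨t, htp, hts, ht⟩ := htwo
      exact exists_ne_isGTPattern_of_two_drops hl hp hsum hts htp hsp ht hs
    push Not at htwo
    have hle : ∀ i ≤ s, μ.rowLen i = μ.rowLen s := by
      intro i hi
      have h := hconst 0 s (Nat.zero_le s) fun i _ h => not_lt.2 (htwo i (by omega) h.ne)
      rw [h i (Nat.zero_le i) hi, h s (Nat.zero_le s) le_rfl]
    have hgt : ∀ i, s < i → i ≤ p → μ.rowLen i = μ.rowLen (s + 1) :=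
      hconst (s + 1) p hsp fun i h h' => not_lt.2 (htwo i h' (by omega))
    by_cases h0 : s = 0
    · subst h0
      refine absurd (Or.inr (Or.inr (Or.inr (Or.inl ⟨μ.rowLen 0, μ.rowLen 1, hs, fun i => ?_⟩)))) hex
      rcases i with _ | i
      · simp
      · rw [List.getD_cons_succ]
        by_cases hi : i < p
        · rw [List.getD_replicate _ (by omega)]
          exact hgt (i + 1) (by omega) hi
        · rw [List.getD_eq_default _ _ (by simp; omega), hp _ (by omega)]
    by_cases h1 : s + 1 = p
    · subst h1
      refine absurd (Or.inr (Or.inr (Or.inr (Or.inr ⟨μ.rowLen s, μ.rowLen (s + 1), hs,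
        fun i => ?_⟩)))) hex
      rcases lt_trichotomy i (s + 1) with hi | rfl | hi
      · rw [List.getD_append _ _ _ _ (by simp; omega), List.getD_replicate _ (by omega)]
        exact hle i (by omega)
      · rw [List.getD_append_right _ _ _ _ (by simp)]
        simp
      · rw [List.getD_eq_default _ _ (by simp; omega), hp _ (by omega)]
    exact exists_ne_isGTPattern_of_inner_drop hl hp hsum (by omega) (by omega) hs hle hgt
  · push Not at hdrop
    have h := hconst 0 p (Nat.zero_le p) fun i _ h => not_lt.2 (hdrop i h)
    have hk : μ.rowLen 0 = k := by
      rw [Finset.sum_congr rfl fun i hi => h i (Nat.zero_le i)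
        (Nat.le_of_lt_succ (Finset.mem_range.1 hi))] at hsum
      simpa using hsum
    refine absurd (Or.inr (Or.inl fun i => ?_)) hex
    by_cases hi : i < p + 1
    · rw [List.getD_replicate _ hi, h i (Nat.zero_le i) (by omega), hk]
    · rw [List.getD_eq_default _ _ (by simp; omega), hp _ (by omega)]

theorem mainTheorem4 (p k : ℕ) (hp : 0 < p) (hk : 0 < k) (μ : YoungDiagram)
    (hcard : μ.card = p * k) (hlen : μ.colLen 0 ≤ p) :
    (¬ μ.IsExceptional p k →
      (∀ d : ℕ, (0 : ℤ) ≤ (tableauCount p (d * k) (μ.dilate d) : ℤ)) ∧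
      Monotone (fun d : ℕ => tableauCount p (d * k) (μ.dilate d)) ∧
      ∃ (n : ℕ) (coef : ℕ → ℕ → ℚ), 0 < n ∧
        IsQuasiPolynomial (fun d : ℕ => tableauCount p (d * k) (μ.dilate d)) n coef ∧
        ∃ a : ℚ, ∀ d : ℕ, coef n d = a) ∧
    (μ.IsExceptional p k →
      ∀ d : ℕ, tableauCount p (d * k) (μ.dilate d) = 1) := by
  have hl : Antitone μ.rowLen := fun i j h => μ.rowLen_anti i j h
  have hv := YoungDiagram.rowLen_eq_zero_of_colLen_le hlen
  have hsum : ∑ i ∈ Finset.range p, μ.rowLen i = p * k := (μ.sum_rowLen hv).trans hcard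
  have hcount : ∀ d : ℕ, tableauCount p (d * k) (μ.dilate d) =
      {x | IsGTPattern p (d * k) (fun i => d * μ.rowLen i) x}.ncard := by
    intro d
    rw [tableauCount_eq_ncard, funext (YoungDiagram.rowLen_dilate d μ)]
    intro i hi
    rw [YoungDiagram.rowLen_dilate, hv i hi, mul_zero]
  have hne := exists_isGTPattern hl hv hsum
  simp only [hcount]
  refine ⟨fun hex => ⟨fun d => Int.natCast_nonneg _, monotone_ncard_gtPattern hv hne, ?_⟩,
    fun hex d => ?_⟩
  · refine (isQuasiPoly_ncard_gtPattern p k hl hv hne).exists_isQuasiPolynomial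
      (monotone_ncard_gtPattern hv hne) ?_
    obtain ⟨q, rfl⟩ : ∃ q, p = q + 1 := ⟨p - 1, by omega⟩
    obtain ⟨x, y, hxy, hx, hy⟩ := YoungDiagram.exists_ne_isGTPattern hv hsum hex
    exact lt_ncard_gtPattern hv hxy hx hy
  · obtain ⟨x, hx⟩ := hne
    refine Set.ncard_eq_one.2 ⟨d • x, Set.eq_singleton_iff_unique_mem.2 ⟨hx.nsmul d,
      fun y hy => ?_⟩⟩
    rcases hex.exists_const with ⟨c, hc⟩ | ⟨c, hc⟩
    · exact hy.unique_of_tail (hx.nsmul d) (c := d * c) fun i h1 h2 => by rw [hc i h1 h2]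
    · exact hy.unique_of_init (hx.nsmul d) (c := d * c) fun i h1 => by rw [hc i h1]
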